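/- Let $I=\mathbb{R}$ or $I=[a_1,a_2]$ with $-\infty<a_1<a_2<\infty$. For real functions $v,w$ of $(x,t)$ (space, time), we say that the equations $$v_t=-v_x\,\mathbf 1_{\{v>w\}},\qquad w_t=w_x\,\mathbf 1_{\{v>w\}}$$ hold on a set $D\subset I\times[0,\infty)$ (in the weak sense of characteristics) if for every rectangle $F=(I\cap(p,q))\times(r,s)\subset D$: - if $v>w$ on $F$, then $v(x+\delta,t+\delta)=v(x,t)$ whenever $(x,t),(x+\delta,t+\delta)\in F$, and $w(x-\delta,t+\delta)=w(x,t)$ whenever $(x,t),(x-\delta,t+\delta)\in F$; - if $v=w$ on $F$, then $v(x,t+\delta)=v(x,t)$ and $w(x,t+\delta)=w(x,t)$ whenever $(x,t),(x,t+\delta)\in F$. **Theorem.** Let $v_0,w_0:I\to\mathbb{R}$ be continuous with $v_0\ge w_0$ on $I$ and, if $I=[a_1,a_2]$, with $v_0(a_i)=w_0(a_i)$ for $i=1,2$. Then there exist jointly continuous functions $v,w:I\times[0,\infty)\to\mathbb{R}$ with $v(\cdot,0)=v_0$ and $w(\cdot,0)=w_0$ such that: 1. (constraint) $v(x,t)\ge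 w(x,t)$ for all $x\in I$, $t\ge 0$; 2. (boundary condition) if $I=[a_1,a_2]$, then $v(a_i,t)=w(a_i,t)$ for $i=1,2$ and all $t\ge0$; 3. (thawing condition) for all $s\ge0$ and $x_1<x_2$ with $(x_1,x_2)\subset I$, let $U=\{(x,t): t\ge s,\ x_1+(t-s)<x<x_2-(t-s)\}$. If $\tilde v,\tilde w$ are continuous on $U$, satisfy the equations, the constraint $\tilde v\ge\tilde w$ and the boundary condition ($\tilde v=\tilde w$ at points of $U$ with $x\in\partial I$) on $U$, satisfy $\tilde v>\tilde w$ in the interior of $U$, and $\tilde v(x,s)=v(x,s)$, $\tilde w(x,s)=w(x,s)$ for $x_1<x<x_2$, then $v=\tilde v$ and $w=\tilde w$ in the interior of $U$; 4. (equations) for every relatively open set $D\subset I\times(0,\infty)$ such that either $v>w$ everywhere on $D$ or $v=w$ everywhere on $D$, the equations hold on $D$. -/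

import Mathlib

open Set

/-- Transport equations `v_t = -v_x 1_{v > w}`, `w_t = w_x 1_{v > w}` on a set `D` of space-time,
in the weak sense of characteristics. A pair `(x, t)` is (space, time) and `I` is the space domain.
For every rectangle `F ⊆ D`, relatively open in `I × ℝ`:
* if `v > w` on `F`, then `v` is constant along the lines of slope `1` in `F` and `w` is constant
  along the lines of slope `-1` in `F`;
* if `v = w` on `F`, then `v` and `w` do not depend on time in `F`. -/
def SolvesTransport (I : Set ℝ) (v w : ℝ → ℝ → ℝ) (D : Set (ℝ × ℝ)) : Prop :=
  ∀ (p q r s : ℝ) (F : Set (ℝ × ℝ)), F = (I ∩ Ioo p q) ×ˢ Ioo r s → F ⊆ D →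
    ((∀ x t, (x, t) ∈ F → w x t < v x t) →
      (∀ x t δ, (x, t) ∈ F → (x + δ, t + δ) ∈ F → v (x + δ) (t + δ) = v x t) ∧
      (∀ x t δ, (x, t) ∈ F → (x - δ, t + δ) ∈ F → w (x - δ) (t + δ) = w x t)) ∧
    ((∀ x t, (x, t) ∈ F → v x t = w x t) →
      (∀ x t δ, (x, t) ∈ F → (x, t + δ) ∈ F → v x (t + δ) = v x t) ∧
      (∀ x t δ, (x, t) ∈ F → (x, t + δ) ∈ F → w x (t + δ) = w x t))

/-- The constraint `v ≥ w` on a set `S` of space-time. -/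
def SatisfiesConstraint (v w : ℝ → ℝ → ℝ) (S : Set (ℝ × ℝ)) : Prop :=
  ∀ x t, (x, t) ∈ S → w x t ≤ v x t

/-- The boundary condition `v = w` at the points of `S` whose space coordinate is a boundary point
of `I` (there are none if `I = ℝ`; they are `a₁` and `a₂` if `I = [a₁, a₂]`). -/
def SatisfiesBoundary (I : Set ℝ) (v w : ℝ → ℝ → ℝ) (S : Set (ℝ × ℝ)) : Prop :=
  ∀ x t, (x, t) ∈ S → x ∈ frontier I → v x t = w x t

/-- The triangle with base `(x₁, x₂)` at time `s` (the base is included, the sides are not). -/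
def triangle (s x₁ x₂ : ℝ) : Set (ℝ × ℝ) :=
  {z | s ≤ z.2 ∧ x₁ + (z.2 - s) < z.1 ∧ z.1 < x₂ - (z.2 - s)}

/-- The thawing condition: whenever, on some triangle based at a time `s ≥ 0` on an interval
`(x₁, x₂) ⊆ I`, the system has a continuous solution `(v', w')` that agrees with `(v, w)` on the base
and is liquid (`v' > w'`) in the interior of the triangle, then `(v, w)` agrees with `(v', w')`
in the interior of the triangle. -/
def SatisfiesThawing (I : Set ℝ) (v w : ℝ → ℝ → ℝ) : Prop :=
  ∀ s x₁ x₂ : ℝ, 0 ≤ s → x₁ < x₂ → Ioo x₁ x₂ ⊆ I →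
    ∀ v' w' : ℝ → ℝ → ℝ,
      ContinuousOn (fun z : ℝ × ℝ => v' z.1 z.2) (triangle s x₁ x₂) →
      ContinuousOn (fun z : ℝ × ℝ => w' z.1 z.2) (triangle s x₁ x₂) →
      SolvesTransport I v' w' (triangle s x₁ x₂) →
      SatisfiesConstraint v' w' (triangle s x₁ x₂) →
      SatisfiesBoundary I v' w' (triangle s x₁ x₂) →
      (∀ x t, (x, t) ∈ interior (triangle s x₁ x₂) → w' x t < v' x t) →
      (∀ x ∈ Ioo x₁ x₂, v' x s = v x s ∧ w' x s = w x s) →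
      ∀ x t, (x, t) ∈ interior (triangle s x₁ x₂) → v x t = v' x t ∧ w x t = w' x t

/-! The system is solved one level at a time. For a level `c` let `H_c` be a primitive of the
initial density `1_{v₀ > c} + 1_{w₀ > c} - 1`; it climbs where both fields exceed `c`, descends
where neither does and is flat in between. The point `(x, t)` has characteristic coordinates `a = x
- t`, `b = x + t`. The right-moving field there is the supremum of the levels `c` such that `c < v₀
a` or `H_c` is again at least `H_c a` somewhere on `(a, b]`. The point reflection of space and
values exchanges the two fields and defines the left-moving one. Extending the data by `⊥` to the
left of `I` and by `⊤` to the right turns the ends of `I` into reflecting walls.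

All properties are read off signs of increments of `H_c`. If `upper < c` then `H_c < H_c a` on `(a,
b]`, and if `c < lower` then `H_c < H_c b` on `[a, b)`; both cannot hold, so `w ≤ v`
(`lower_le_upper`). If `v` rises through `c` along its characteristic, then `w` is at least `c`
where `H_c` first regains `H_c a` (`exists_le_lower`). This is impossible while `w` stays below `v`,
so `v` is transported in liquid regions; the same lemma, followed along a left-moving characteristic
to the base of a triangle, gives thawing. In frozen regions a balance of increments forbids `v` to
grow in time (`vSol_le_of_frozen`), its reflection forbids `w` to decrease, and `v = w` makes both
constant.

The delicate half of continuity is `eventually_lt_upper`: the supremum is unstable only if the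
increments of two levels coincide, and then the data skip the levels between them, which leaves only
reflection at the left wall. -/

namespace Freezing

open MeasureTheory Topology Filter

/-! ### Level densities and the variational formula -/

/-- The centred density `1_{f > c} + 1_{g > c} - 1` of the level `c`. -/
noncomputable def density (f g : ℝ → EReal) (c z : ℝ) : ℝ :=
  (if (c : EReal) < f z then 1 else 0) + (if (c : EReal) < g z then 1 else 0) - 1

/-- The increment over `[p, q]` of the height function of the level `c`. -/
noncomputable def gain (f g : ℝ → EReal) (c p q : ℝ) : ℝ :=
  ∫ z in p..q, density f g c z

/-- The value of the right-moving field at the point with characteristic coordinates `a ≤ b`. -/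
noncomputable def upper (f g : ℝ → EReal) (a b : ℝ) : EReal :=
  ⨆ (c : ℝ) (_ : (c : EReal) < f a ∨ ∃ y ∈ Ioc a b, 0 ≤ gain f g c a y), (c : EReal)

/-- Point reflection of a function. -/
noncomputable def flip (u : ℝ → EReal) : ℝ → EReal := fun z => -u (-z)

/-- The value of the left-moving field at the point with characteristic coordinates `a ≤ b`. -/
noncomputable def lower (f g : ℝ → EReal) (a b : ℝ) : EReal :=
  -upper (flip g) (flip f) (-b) (-a)

/-- Regularity of an extended initial pair: both functions are lower semicontinuous from the right
and upper semicontinuous from the left. -/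
structure Admissible (f g : ℝ → EReal) : Prop where
  meas_f : Measurable f
  meas_g : Measurable g
  le : ∀ z, g z ≤ f z
  right_f : ∀ a c, c < f a → ∀ᶠ z in 𝓝[>] a, c < f z
  right_g : ∀ a c, c < g a → ∀ᶠ z in 𝓝[>] a, c < g z
  left_f : ∀ a c, f a < c → ∀ᶠ z in 𝓝[<] a, f z < c
  left_g : ∀ a c, g a < c → ∀ᶠ z in 𝓝[<] a, g z < c

/-! ### Point reflection and estimates of the gain -/

lemma tendsto_neg_right (a : ℝ) : Tendsto (fun z : ℝ => -z) (𝓝[>] a) (𝓝[<] (-a)) := by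
  refine tendsto_nhdsWithin_iff.2 ⟨(continuous_neg.tendsto a).mono_left nhdsWithin_le_nhds, ?_⟩
  filter_upwards [self_mem_nhdsWithin] with z hz
  simpa using hz

lemma tendsto_neg_left (a : ℝ) : Tendsto (fun z : ℝ => -z) (𝓝[<] a) (𝓝[>] (-a)) := by
  refine tendsto_nhdsWithin_iff.2 ⟨(continuous_neg.tendsto a).mono_left nhdsWithin_le_nhds, ?_⟩
  filter_upwards [self_mem_nhdsWithin] with z hz
  simpa using hz

variable {f g : ℝ → EReal}

/-- Reflection swaps the two functions as well as the two one-sided conditions. Every later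
statement about one field therefore yields its dual for the other. -/
lemma Admissible.flip (h : Admissible f g) : Admissible (flip g) (flip f) where
  meas_f := (h.meas_g.comp measurable_neg).neg
  meas_g := (h.meas_f.comp measurable_neg).neg
  le z := EReal.neg_le_neg_iff.2 (h.le _)
  right_f a c hc := by
    have := (tendsto_neg_right a).eventually (h.left_g (-a) (-c) (EReal.lt_neg_comm.1 hc))
    filter_upwards [this] with z hz using EReal.lt_neg_comm.1 hz
  right_g a c hc := by
    have := (tendsto_neg_right a).eventually (h.left_f (-a) (-c) (EReal.lt_neg_comm.1 hc))
    filter_upwards [this] with z hz using EReal.lt_neg_comm.1 hz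
  left_f a c hc := by
    have := (tendsto_neg_left a).eventually (h.right_g (-a) (-c) (EReal.neg_lt_comm.1 hc))
    filter_upwards [this] with z hz using EReal.neg_lt_comm.1 hz
  left_g a c hc := by
    have := (tendsto_neg_left a).eventually (h.right_f (-a) (-c) (EReal.neg_lt_comm.1 hc))
    filter_upwards [this] with z hz using EReal.neg_lt_comm.1 hz

lemma density_anti {c c' : ℝ} (h : c ≤ c') (z : ℝ) : density f g c' z ≤ density f g c z := by
  have h' : (c : EReal) ≤ c' := by exact_mod_cast h
  have key (e : EReal) : (if (c' : EReal) < e then (1 : ℝ) else 0) ≤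
      if (c : EReal) < e then 1 else 0 := by
    split_ifs with h1 h2 <;> norm_num
    exact h2 (h'.trans_lt h1)
  unfold density
  linarith [key (f z), key (g z)]

lemma abs_density_le (c z : ℝ) : |density f g c z| ≤ 1 := by
  unfold density
  split_ifs <;> norm_num

lemma density_of_le (h : ∀ z, g z ≤ f z) {c z : ℝ} (hz : f z ≤ c) : density f g c z = -1 := by
  simp [density, not_lt.2 hz, not_lt.2 ((h z).trans hz)]

lemma density_of_lt (h : ∀ z, g z ≤ f z) {c z : ℝ} (hz : (c : EReal) < g z) :
    density f g c z = 1 := by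
  simp [density, hz, hz.trans_le (h z)]

lemma density_nonneg {c z : ℝ} (hz : (c : EReal) < f z) : 0 ≤ density f g c z := by
  unfold density
  rw [if_pos hz]
  split_ifs <;> norm_num

lemma abs_gain_le (c p q : ℝ) : |gain f g c p q| ≤ |q - p| := by
  have := intervalIntegral.norm_integral_le_of_norm_le_const (a := p) (b := q) (C := 1)
    (f := density f g c) fun z _ => abs_density_le c z
  simpa [gain] using this

lemma neg_gain_eq (c p q : ℝ) :
    -gain f g c p q = ∫ z in (-q)..(-p), -density f g c (-z) := by
  rw [intervalIntegral.integral_neg, intervalIntegral.integral_comp_neg]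
  simp [gain]

lemma gain_le (f g : ℝ → EReal) (c : ℝ) {p q : ℝ} (hpq : p ≤ q) : gain f g c p q ≤ q - p := by
  have := (abs_le.1 (abs_gain_le (f := f) (g := g) c p q)).2
  rwa [abs_of_nonneg (sub_nonneg.2 hpq)] at this

lemma le_gain (f g : ℝ → EReal) (c : ℝ) {p q : ℝ} (hpq : p ≤ q) : -(q - p) ≤ gain f g c p q := by
  have := (abs_le.1 (abs_gain_le (f := f) (g := g) c p q)).1
  rwa [abs_of_nonneg (sub_nonneg.2 hpq)] at this

namespace Admissible

variable (h : Admissible f g)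
include h

lemma intervalIntegrable (c p q : ℝ) : IntervalIntegrable (density f g c) volume p q := by
  have hm : Measurable (density f g c) := by
    have hf : MeasurableSet {z | (c : EReal) < f z} := measurableSet_lt measurable_const h.meas_f
    have hg : MeasurableSet {z | (c : EReal) < g z} := measurableSet_lt measurable_const h.meas_g
    exact ((Measurable.ite hf measurable_const measurable_const).add
      (Measurable.ite hg measurable_const measurable_const)).sub measurable_const
  refine (intervalIntegrable_const (c := (1 : ℝ))).mono_fun hm.aestronglyMeasurable ?_
  refine Eventually.of_forall fun z => ?_
  simpa using abs_density_le c z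

lemma gain_add (c p q r : ℝ) : gain f g c p q + gain f g c q r = gain f g c p r :=
  intervalIntegral.integral_add_adjacent_intervals (h.intervalIntegrable c p q)
    (h.intervalIntegrable c q r)

lemma continuous_gain (c p : ℝ) : Continuous fun q => gain f g c p q :=
  intervalIntegral.continuous_primitive (fun a b => h.intervalIntegrable c a b) p

lemma gain_anti {c c' : ℝ} (hc : c ≤ c') {p q : ℝ} (hpq : p ≤ q) :
    gain f g c' p q ≤ gain f g c p q :=
  intervalIntegral.integral_mono_on hpq (h.intervalIntegrable _ _ _) (h.intervalIntegrable _ _ _)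
    fun z _ => density_anti hc z

lemma gain_of_le {c p q : ℝ} (hpq : p ≤ q) (hz : ∀ z ∈ Ioo p q, f z ≤ c) :
    gain f g c p q = -(q - p) := by
  have : gain f g c p q = ∫ _ in p..q, (-1 : ℝ) := by
    refine intervalIntegral.integral_congr_Ioo_of_le hpq fun z hz' => density_of_le h.le (hz z hz')
  rw [this]; simp

lemma gain_of_lt {c p q : ℝ} (hpq : p ≤ q) (hz : ∀ z ∈ Ioo p q, (c : EReal) < g z) :
    gain f g c p q = q - p := by
  have : gain f g c p q = ∫ _ in p..q, (1 : ℝ) := by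
    refine intervalIntegral.integral_congr_Ioo_of_le hpq fun z hz' => density_of_lt h.le (hz z hz')
  rw [this]; simp

lemma gain_nonneg {c p q : ℝ} (hpq : p ≤ q) (hz : ∀ z ∈ Ioo p q, (c : EReal) < f z) :
    0 ≤ gain f g c p q := by
  have : (∫ _ in p..q, (0 : ℝ)) ≤ gain f g c p q :=
    intervalIntegral.integral_mono_on_of_le_Ioo hpq intervalIntegrable_const
      (h.intervalIntegrable _ _ _) fun z hz' => density_nonneg (hz z hz')
  simpa using this

/-- A level set of positive measure between two levels makes the gain strictly monotone. -/
lemma gain_lt_of_drop {c c' : ℝ} (hc : c ≤ c') {a p q y : ℝ} (hap : a ≤ p) (hpq : p < q)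
    (hqy : q ≤ y) (hz : ∀ z ∈ Ioo p q, density f g c' z + 1 ≤ density f g c z) :
    gain f g c' a y < gain f g c a y := by
  have h1 := h.gain_anti hc hap
  have h3 := h.gain_anti hc hqy
  have h2 : gain f g c' p q + (q - p) ≤ gain f g c p q := by
    have := intervalIntegral.integral_mono_on_of_le_Ioo hpq.le
      ((h.intervalIntegrable c' p q).add intervalIntegrable_const)
      (h.intervalIntegrable c p q) hz
    rw [intervalIntegral.integral_add (h.intervalIntegrable c' p q) intervalIntegrable_const]
      at this
    simpa [gain] using this
  rw [← h.gain_add c' a q y, ← h.gain_add c a q y, ← h.gain_add c' a p q, ← h.gain_add c a p q]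
  linarith

/-- The density is `-1` on more than half of `[a, y]`, and the rest can contribute at most its
length. -/
lemma gain_neg {c a m y : ℝ} (hay : a < y) (ham : a < m) (hm : a + y < 2 * m)
    (hf : ∀ z ∈ Ioo a m, f z ≤ c) : gain f g c a y < 0 := by
  rcases le_total y m with hy | hy
  · rw [h.gain_of_le hay.le fun z hz => hf z ⟨hz.1, hz.2.trans_le hy⟩]
    linarith
  · rw [← h.gain_add c a m y, h.gain_of_le ham.le hf]
    linarith [gain_le f g c hy]

end Admissible

/-! ### The two fields in characteristic coordinates -/

section upper

lemma le_upper (a b : ℝ) : f a ≤ upper f g a b := by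
  refine le_of_forall_lt fun c hc => ?_
  obtain ⟨r, hr, hr'⟩ := EReal.lt_iff_exists_real_btwn.1 hc
  exact hr.trans_le (le_iSup₂_of_le r (Or.inl hr') le_rfl)

lemma upper_self (a : ℝ) : upper f g a a = f a := by
  refine le_antisymm (iSup₂_le fun c hc => ?_) (le_upper a a)
  rcases hc with hc | ⟨y, hy, -⟩
  · exact hc.le
  · simp at hy

lemma lower_self (a : ℝ) : lower f g a a = g a := by
  simp [lower, upper_self, flip]

lemma le_upper_of_gain {c a b y : ℝ} (hy : y ∈ Ioc a b) (hg : 0 ≤ gain f g c a y) :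
    (c : EReal) ≤ upper f g a b :=
  le_iSup₂_of_le c (Or.inr ⟨y, hy, hg⟩) le_rfl

lemma upper_mono {a b b' : ℝ} (hb : b ≤ b') : upper f g a b ≤ upper f g a b' := by
  refine iSup₂_le fun c hc => le_iSup₂_of_le c ?_ le_rfl
  exact hc.imp_right fun ⟨y, hy, hy'⟩ => ⟨y, ⟨hy.1, hy.2.trans hb⟩, hy'⟩

lemma lower_mono {a a' b : ℝ} (ha : a ≤ a') : lower f g a b ≤ lower f g a' b :=
  EReal.neg_le_neg_iff.2 (upper_mono (neg_le_neg ha))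

lemma gain_neg_of_upper_lt {c a b : ℝ} (hc : upper f g a b < c) {y : ℝ} (hy : y ∈ Ioc a b) :
    gain f g c a y < 0 := by
  by_contra! hg
  exact absurd (le_upper_of_gain hy hg) (not_le.2 hc)

lemma upper_le {c a b : ℝ} (hf : f a ≤ c) (hg : ∀ y ∈ Ioc a b, gain f g c a y < 0)
    (h : Admissible f g) : upper f g a b ≤ c := by
  refine iSup₂_le fun r hr => ?_
  by_contra! hcr
  rcases hr with hr | ⟨y, hy, hr⟩
  · exact absurd (hcr.trans hr) (not_lt.2 hf)
  · have hcr' : c ≤ r := by exact_mod_cast hcr.le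
    exact absurd (h.gain_anti hcr' hy.1.le) (not_le.2 ((hg y hy).trans_le hr))

lemma upper_flip (a b : ℝ) : upper (flip g) (flip f) (-b) (-a) = -lower f g a b := by
  simp [lower]

variable (h : Admissible f g)
include h

/-- The alternative `c < f a` is absorbed into the other one: by semicontinuity from the right the
density is nonnegative just after `a`. -/
lemma exists_of_lt_upper {c a b : ℝ} (hab : a < b) (hc : c < upper f g a b) :
    ∃ y ∈ Ioc a b, 0 ≤ gain f g c a y := by
  simp only [upper, lt_iSup_iff] at hc
  obtain ⟨r, hr, hcr⟩ := hc
  have hcr' : c ≤ r := by exact_mod_cast hcr.le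
  rcases hr with hr | ⟨y, hy, hr⟩
  · obtain ⟨u, hu, hu'⟩ := mem_nhdsGT_iff_exists_Ioc_subset.1 (h.right_f a c (hcr.trans hr))
    refine ⟨min u b, ⟨lt_min hu hab, min_le_right _ _⟩, h.gain_nonneg (lt_min hu hab).le ?_⟩
    exact fun z hz => hu' ⟨hz.1, hz.2.le.trans (min_le_left _ _)⟩
  · exact ⟨y, hy, hr.trans (h.gain_anti hcr' hy.1.le)⟩

lemma intervalIntegrable_density_neg (c p q : ℝ) :
    IntervalIntegrable (fun z => -density f g c (-z)) volume (-q) (-p) :=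
  (((IntervalIntegrable.iff_comp_neg).1 (h.intervalIntegrable c q p))).neg

/-- Reflection turns the strict superlevel sets in `density` into strict sublevel sets, so gains are
not exactly antisymmetric. This lemma and `le_gain_flip` give the two inequalities, the second with
a strict gap between the levels. -/
lemma gain_flip_le {c d : ℝ} (hcd : -d ≤ c) {p q : ℝ} (hpq : p ≤ q) :
    gain (flip g) (flip f) d (-q) (-p) ≤ -gain f g c p q := by
  have hcd' : (-d : EReal) ≤ c := by exact_mod_cast hcd
  rw [neg_gain_eq]
  refine intervalIntegral.integral_mono_on (neg_le_neg hpq) (h.flip.intervalIntegrable _ _ _)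
    (intervalIntegrable_density_neg h c p q) fun z _ => ?_
  have key (e : EReal) : (if (d : EReal) < -e then (1 : ℝ) else 0) ≤
      1 - if (c : EReal) < e then 1 else 0 := by
    split_ifs with h1 h2 <;> norm_num
    exact absurd (hcd'.trans_lt h2) (not_lt.2 (EReal.lt_neg_comm.1 h1).le)
  have h1 := key (f (-z))
  have h2 := key (g (-z))
  unfold density flip
  linarith

lemma le_gain_flip {c d : ℝ} (hcd : c < -d) {p q : ℝ} (hpq : p ≤ q) :
    -gain f g c p q ≤ gain (flip g) (flip f) d (-q) (-p) := by
  have hcd' : (c : EReal) < -d := by exact_mod_cast hcd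
  rw [neg_gain_eq]
  refine intervalIntegral.integral_mono_on (neg_le_neg hpq)
    (intervalIntegrable_density_neg h c p q) (h.flip.intervalIntegrable _ _ _) fun z _ => ?_
  have key (e : EReal) : (1 - if (c : EReal) < e then (1 : ℝ) else 0) ≤
      if (d : EReal) < -e then 1 else 0 := by
    split_ifs with h1 h2 h2 <;> norm_num
    exact h2 (EReal.lt_neg_comm.1 ((not_lt.1 h1).trans_lt hcd'))
  have h1 := key (f (-z))
  have h2 := key (g (-z))
  unfold density flip
  linarith

lemma gain_pos_of_lt_lower {c a b : ℝ} (hc : c < lower f g a b) {y : ℝ} (hy : y ∈ Ico a b) :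
    0 < gain f g c y b := by
  obtain ⟨d, hd, hd'⟩ := EReal.lt_iff_exists_real_btwn.1 (EReal.lt_neg_comm.1 hc)
  have h1 := gain_neg_of_upper_lt hd (y := -y) ⟨neg_lt_neg hy.2, neg_le_neg hy.1⟩
  have h2 : (d : ℝ) < -c := by exact_mod_cast hd'
  linarith [le_gain_flip h (c := c) (d := d) (by linarith) hy.2.le]

lemma exists_of_lower_lt {c a b : ℝ} (hab : a < b) (hc : lower f g a b < c) :
    ∃ y ∈ Ico a b, gain f g c y b ≤ 0 := by
  have hc' : ((-c : ℝ) : EReal) < upper (flip g) (flip f) (-b) (-a) := by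
    have := EReal.neg_lt_comm.1 hc
    exact_mod_cast this
  obtain ⟨y, hy, hy'⟩ := exists_of_lt_upper h.flip (neg_lt_neg hab) hc'
  refine ⟨-y, ⟨le_neg.1 hy.2, neg_lt.1 hy.1⟩, ?_⟩
  have := gain_flip_le h (c := c) (d := -c) (by simp) (neg_lt.1 hy.1).le
  rw [neg_neg] at this
  linarith

/-- A level strictly between the two values would make the gain over all of `[a, b]` both negative
and positive. -/
lemma lower_le_upper {a b : ℝ} (hab : a ≤ b) : lower f g a b ≤ upper f g a b := by
  rcases hab.eq_or_lt with rfl | hab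
  · rw [lower_self, upper_self]; exact h.le a
  by_contra! hlt
  obtain ⟨c, hc, hc'⟩ := EReal.lt_iff_exists_real_btwn.1 hlt
  exact lt_asymm (gain_neg_of_upper_lt hc ⟨hab, le_rfl⟩)
    (gain_pos_of_lt_lower h hc' ⟨le_rfl, hab⟩)

/-- If the right-moving field changes along its characteristic, then the left-moving field attains
an intermediate level there. -/
lemma exists_le_lower {c a b b' : ℝ} (hab : a < b) (hb : b ≤ b') (hc : upper f g a b < c)
    (hc' : c < upper f g a b') : ∃ y ∈ Ioc b b', ∀ a' ∈ Ioo a y, (c : EReal) ≤ lower f g a' y := by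
  obtain ⟨y₀, hy₀, hg₀⟩ := exists_of_lt_upper h (hab.trans_le hb) hc'
  have hneg : ∀ y ∈ Ioc a b, gain f g c a y < 0 := fun y hy => gain_neg_of_upper_lt hc hy
  have hby₀ : b < y₀ := by
    by_contra! hle
    exact absurd hg₀ (not_le.2 (hneg y₀ ⟨hy₀.1, hle⟩))
  set S := Icc b y₀ ∩ {y | 0 ≤ gain f g c a y} with hS
  have hSc : IsCompact S :=
    isCompact_Icc.inter_right (isClosed_le continuous_const (h.continuous_gain c a))
  -- `y` is the first point at which the gain from `a` is nonnegative again. The gain from `a` to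
  -- any earlier `z` is negative, so the gain from `z` to `y` is positive, which bounds the
  -- left-moving field from below.
  obtain ⟨y, hyS, hmin⟩ := hSc.exists_isLeast ⟨y₀, ⟨hby₀.le, le_rfl⟩, hg₀⟩
  have hby : b < y := by
    by_contra! hle
    exact absurd hyS.2 (not_le.2 (hneg y ⟨hab.trans_le hyS.1.1, hle⟩))
  refine ⟨y, ⟨hby, hyS.1.2.trans hy₀.2⟩, fun a' ha' => ?_⟩
  by_contra! hlt
  obtain ⟨z, hz, hz'⟩ := exists_of_lower_lt h ha'.2 hlt
  have h1 : gain f g c a z < 0 := by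
    rcases le_or_gt z b with hzb | hzb
    · exact hneg z ⟨ha'.1.trans_le hz.1, hzb⟩
    · by_contra! hge
      exact absurd (hmin ⟨⟨hzb.le, hz.2.le.trans hyS.1.2⟩, hge⟩) (not_le.2 hz.2)
  have h2 := h.gain_add c a z y
  have h3 : 0 ≤ gain f g c a y := hyS.2
  linarith

/-- In a frozen region the fields cannot increase in time. -/
lemma not_upper_lt_lt_lower {c x t t' : ℝ} (ht : 0 < t) (htt : t ≤ t')
    (hf : ∀ z ∈ Ioo (x - t') (x - t), f z ≤ c) (hc : upper f g (x - t) (x + t) < c) :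
    lower f g (x - t') (x + t') ≤ c := by
  by_contra! hlt
  -- The gain over `[x - t', x + t']` would be positive, but its three pieces are equal to `-(t' -
  -- t)`, negative, and at most `t' - t`.
  have h1 := gain_pos_of_lt_lower h hlt (y := x - t') ⟨le_rfl, by linarith⟩
  have h2 := gain_neg_of_upper_lt hc (y := x + t) ⟨by linarith, le_rfl⟩
  have h3 := h.gain_of_le (by linarith) hf
  have h4 := gain_le f g c (p := x + t) (q := x + t') (by linarith)
  have h5 := h.gain_add c (x - t') (x - t) (x + t)
  have h6 := h.gain_add c (x - t') (x + t) (x + t')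
  linarith

/-- The condition on `m` says that it lies to the right of the midpoint, which is the space
coordinate; `gain_neg` then applies to every `y ≤ b`. -/
lemma upper_le_of_forall {c a b m : ℝ} (ham : a < m) (hm : a + b < 2 * m)
    (hf : ∀ z ∈ Ico a m, f z ≤ c) : upper f g a b ≤ c :=
  upper_le (hf a ⟨le_rfl, ham⟩) (fun y hy => h.gain_neg hy.1 ham (by linarith [hy.2])
    fun z hz => hf z ⟨hz.1.le, hz.2⟩) h

/-- Reflection at a wall `l`: whatever is lost on `[a, l]` is regained on the mirror interval `[l, 2
* l - a]`, where the density is `1`. -/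
lemma le_upper_of_forall {c a b l : ℝ} (hal : a < l) (hl : 2 * l ≤ a + b)
    (hg : ∀ z ∈ Ioo l (2 * l - a), c < g z) : (c : EReal) ≤ upper f g a b := by
  refine le_upper_of_gain (y := 2 * l - a) ⟨by linarith, by linarith⟩ ?_
  rw [← h.gain_add c a l, h.gain_of_lt (by linarith) hg]
  linarith [le_gain f g c hal.le]

/-- Close to `a` the density is `-1`, and away from `a` compactness makes the gain uniformly
negative. Both survive a small change of the endpoints. -/
lemma eventually_upper_lt {a b : ℝ} (hf : ∀ c, f a < c → ∀ᶠ z in 𝓝 a, f z < c)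
    {c : EReal} (hc : upper f g a b < c) : ∀ᶠ z : ℝ × ℝ in 𝓝 (a, b), upper f g z.1 z.2 < c := by
  obtain ⟨r, hr, hrc⟩ := EReal.lt_iff_exists_real_btwn.1 hc
  obtain ⟨δ, hδ, hδ'⟩ := Metric.eventually_nhds_iff.1 (hf r ((le_upper a b).trans_lt hr))
  have hdec : ∀ z, |z - a| < δ → f z < r := fun z hz => hδ' (by rwa [Real.dist_eq])
  obtain ⟨ε, hε, hgap⟩ : ∃ ε > 0, ∀ y ∈ Icc (a + δ / 2) b, gain f g r a y ≤ -ε := by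
    rcases lt_or_ge b (a + δ / 2) with hlt | hge
    · exact ⟨1, one_pos, fun y hy => absurd (hy.1.trans hy.2) (not_le.2 hlt)⟩
    obtain ⟨y, hy, hmax⟩ := isCompact_Icc.exists_isMaxOn (nonempty_Icc.2 hge)
      (h.continuous_gain r a).continuousOn
    refine ⟨-gain f g r a y, ?_, fun z hz => by simpa using hmax hz⟩
    have := gain_neg_of_upper_lt hr (y := y) ⟨by linarith [hy.1], hy.2⟩
    linarith
  have hη : 0 < min (δ / 2) (ε / 3) := by positivity
  filter_upwards [Metric.ball_mem_nhds (a, b) hη] with ⟨a', b'⟩ hz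
  rw [Metric.mem_ball, Prod.dist_eq, max_lt_iff, Real.dist_eq, Real.dist_eq] at hz
  obtain ⟨ha, hb⟩ := hz
  simp only at ha hb ⊢
  have haδ := abs_lt.1 (ha.trans_le (min_le_left _ _))
  have haε := abs_lt.1 (ha.trans_le (min_le_right _ _))
  have hbδ := abs_lt.1 (hb.trans_le (min_le_left _ _))
  have hbε := abs_lt.1 (hb.trans_le (min_le_right _ _))
  refine (upper_le (hdec a' (by rw [abs_lt]; constructor <;> linarith)).le (fun y hy => ?_)
    h).trans_lt hrc
  rcases lt_or_ge y (a + δ) with hya | hya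
  · refine h.gain_neg hy.1 hy.1 (by linarith [hy.1]) fun z hz => (hdec z ?_).le
    rw [abs_lt]; constructor <;> linarith [hz.1, hz.2]
  have h1 : gain f g r a (min y b) ≤ -ε :=
    hgap _ ⟨le_min (by linarith) (by linarith [hy.2]), min_le_right _ _⟩
  have h2 : gain f g r (min y b) y ≤ ε / 3 := by
    refine (gain_le f g r (min_le_left _ _)).trans ?_
    rcases le_total y b with hyb | hyb
    · rw [min_eq_left hyb]; linarith
    · rw [min_eq_right hyb]; linarith [hy.2]
  have h3 : gain f g r a' a ≤ ε / 3 :=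
    (le_abs_self _).trans ((abs_gain_le r a' a).trans (by
      rw [abs_le]; constructor <;> linarith))
  rw [← h.gain_add r a' a y, ← h.gain_add r a (min y b) y]
  linarith

end upper

/-! ### Initial data, walls and the extension to the line -/

/-- Initial data on `ℝ` or on a compact interval. -/
structure InitialData (I : Set ℝ) (v₀ w₀ : ℝ → ℝ) : Prop where
  dom : I = univ ∨ ∃ a₁ a₂ : ℝ, a₁ < a₂ ∧ I = Icc a₁ a₂
  cont_v : ContinuousOn v₀ I
  cont_w : ContinuousOn w₀ I
  le : ∀ x ∈ I, w₀ x ≤ v₀ x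
  bdry : ∀ x ∈ frontier I, v₀ x = w₀ x

open Classical in
/-- Extension of a function on an interval `I` by `⊥` to the left and by `⊤` to the right. -/
noncomputable def extend (I : Set ℝ) (u : ℝ → ℝ) (z : ℝ) : EReal :=
  if z ∈ I then (u z : EReal) else if ∃ y ∈ I, z < y then ⊥ else ⊤

/-- Point reflection of a real function. -/
def rflip (u : ℝ → ℝ) : ℝ → ℝ := fun z => -u (-z)

/-- Point reflection of a set. -/
def sflip (I : Set ℝ) : Set ℝ := {z | -z ∈ I}

lemma rflip_rflip (u : ℝ → ℝ) : rflip (rflip u) = u := by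
  funext z; simp [rflip]

lemma sflip_sflip (I : Set ℝ) : sflip (sflip I) = I := by
  ext z; simp [sflip]

lemma sflip_eq (I : Set ℝ) : sflip I = Homeomorph.neg ℝ ⁻¹' I := rfl

lemma frontier_sflip (I : Set ℝ) : frontier (sflip I) = sflip (frontier I) := by
  rw [sflip_eq, ← Homeomorph.preimage_frontier]; rfl

variable {I : Set ℝ} {v₀ w₀ : ℝ → ℝ}

lemma continuousOn_rflip {u : ℝ → ℝ} (hu : ContinuousOn u I) :
    ContinuousOn (rflip u) (sflip I) :=
  (hu.comp continuous_neg.continuousOn fun _ hz => hz).neg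

namespace InitialData

variable (h : InitialData I v₀ w₀)
include h

lemma flip : InitialData (sflip I) (rflip w₀) (rflip v₀) where
  dom := by
    rcases h.dom with h | ⟨a, b, hab, h⟩
    · left; simp [sflip, h]
    · refine Or.inr ⟨-b, -a, neg_lt_neg hab, ?_⟩
      ext z
      simp only [sflip, h, mem_Icc, mem_ofPred_eq]
      constructor <;> rintro ⟨_, _⟩ <;> constructor <;> linarith
  cont_v := continuousOn_rflip h.cont_w
  cont_w := continuousOn_rflip h.cont_v
  le x hx := neg_le_neg (h.le _ hx)
  bdry x hx := by
    rw [frontier_sflip] at hx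
    simp only [rflip, h.bdry _ hx]

lemma ordConnected : I.OrdConnected := by
  rcases h.dom with h | ⟨a, b, -, h⟩ <;> rw [h] <;> infer_instance

lemma isClosed : IsClosed I := by
  rcases h.dom with h | ⟨a, b, -, h⟩ <;> rw [h]
  exacts [isClosed_univ, isClosed_Icc]

lemma exists_left {a x : ℝ} (ha : a ∉ I) (hx : x ∈ I) (hax : a ≤ x) :
    ∃ l ∈ I, a < l ∧ l ≤ x ∧ ∀ y ∈ I, l ≤ y := by
  rcases h.dom with h | ⟨l, r, hlr, rfl⟩
  · simp [h] at ha
  · refine ⟨l, ⟨le_rfl, hlr.le⟩, ?_, hx.1, fun y hy => hy.1⟩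
    by_contra! hle
    exact ha ⟨hle, hax.trans hx.2⟩

lemma mem_frontier_iff {x : ℝ} (hx : x ∈ I) :
    x ∈ frontier I ↔ (∀ y ∈ I, y ≤ x) ∨ ∀ y ∈ I, x ≤ y := by
  rcases h.dom with rfl | ⟨l, r, hlr, rfl⟩
  · simp only [frontier_univ, mem_empty_iff_false, mem_univ, forall_const, false_iff, not_or,
      not_forall, not_le]
    exact ⟨exists_gt x, exists_lt x⟩
  · rw [frontier_Icc hlr.le]
    constructor
    · rintro (rfl | rfl)
      · exact Or.inr fun y hy => hy.1
      · exact Or.inl fun y hy => hy.2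
    · rintro (h | h)
      · exact Or.inr (le_antisymm hx.2 (h r ⟨hlr.le, le_rfl⟩))
      · exact Or.inl (le_antisymm (h l ⟨le_rfl, hlr.le⟩) hx.1)

lemma exists_ne (x : ℝ) : ∃ y ∈ I, y ≠ x := by
  rcases h.dom with rfl | ⟨l, r, hlr, rfl⟩
  · obtain ⟨y, hy⟩ := exists_gt x
    exact ⟨y, trivial, hy.ne'⟩
  · by_cases hx : x = l
    · exact ⟨r, ⟨hlr.le, le_rfl⟩, by rw [hx]; exact hlr.ne'⟩
    · exact ⟨l, ⟨le_rfl, hlr.le⟩, Ne.symm hx⟩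

lemma not_max_of_min {x : ℝ} (hx : ∀ y ∈ I, x ≤ y) : ∃ y ∈ I, x < y := by
  obtain ⟨y, hy, hne⟩ := h.exists_ne x
  exact ⟨y, hy, lt_of_le_of_ne (hx y hy) hne.symm⟩

lemma not_min_of_max {x : ℝ} (hx : ∀ y ∈ I, y ≤ x) : ∃ y ∈ I, y < x := by
  obtain ⟨y, hy, hne⟩ := h.exists_ne x
  exact ⟨y, hy, lt_of_le_of_ne (hx y hy) hne⟩

end InitialData

lemma extend_of_mem {u : ℝ → ℝ} {z : ℝ} (hz : z ∈ I) : extend I u z = u z := by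
  simp [extend, hz]

lemma extend_of_lt {u : ℝ → ℝ} {z y : ℝ} (hz : z ∉ I) (hy : y ∈ I)
    (hzy : z < y) : extend I u z = ⊥ := by
  rw [extend, if_neg hz, if_pos ⟨y, hy, hzy⟩]

lemma extend_of_gt (hI : I.OrdConnected) {u : ℝ → ℝ} {z y : ℝ} (hz : z ∉ I) (hy : y ∈ I)
    (hzy : y < z) : extend I u z = ⊤ := by
  rw [extend, if_neg hz, if_neg]
  rintro ⟨y', hy', hzy'⟩
  exact hz (hI.out hy hy' ⟨hzy.le, hzy'.le⟩)

lemma extend_flip (hI : I.OrdConnected) (hne : I.Nonempty) (u : ℝ → ℝ) :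
    extend (sflip I) (rflip u) = flip (extend I u) := by
  have hI' : (sflip I).OrdConnected := hI.preimage_anti fun _ _ => neg_le_neg
  funext z
  by_cases hz : -z ∈ I
  · rw [flip, extend_of_mem hz, extend_of_mem (show z ∈ sflip I from hz)]
    simp [rflip]
  · obtain ⟨y, hy⟩ := hne
    have hy' : -y ∈ sflip I := by simpa [sflip] using hy
    rcases lt_or_gt_of_ne (show -z ≠ y from fun e => hz (e ▸ hy)) with hlt | hlt
    · rw [flip, extend_of_lt hz hy hlt,
        extend_of_gt hI' (show z ∉ sflip I from hz) hy' (by linarith)]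
      simp
    · rw [flip, extend_of_gt hI hz hy hlt,
        extend_of_lt (show z ∉ sflip I from hz) hy' (by linarith)]
      simp

lemma measurable_extend (hI : IsClosed I) {u : ℝ → ℝ}
    (hu : ContinuousOn u I) : Measurable (extend I u) := by
  classical
  have hB : MeasurableSet {z | ∃ y ∈ I, z < y} := by
    have : {z | ∃ y ∈ I, z < y} = ⋃ y ∈ I, Iio y := by ext; simp
    rw [this]
    exact (isOpen_biUnion fun _ _ => isOpen_Iio).measurableSet
  refine measurable_of_restrict_of_restrict_compl hI.measurableSet ?_ ?_
  · have : I.domRestrict (extend I u) = fun z : I => ((I.domRestrict u z : ℝ) : EReal) := by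
      funext z; simp [extend]
    rw [this]
    exact (continuous_coe_real_ereal.comp hu.domRestrict).measurable
  · have : Iᶜ.domRestrict (extend I u) =
        fun z : (Iᶜ : Set ℝ) => if (z : ℝ) ∈ {z | ∃ y ∈ I, z < y} then (⊥ : EReal) else ⊤ := by
      funext z
      have hz : (z : ℝ) ∉ I := z.2
      simp only [domRestrict_apply, extend, if_neg hz, mem_ofPred_eq]
    rw [this]
    exact Measurable.ite (measurable_subtype_coe hB) measurable_const measurable_const

/-- The extension is discontinuous only at the ends of `I`, where it jumps upwards from left to
right; this is what the one-sided conditions of `Admissible` allow. -/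
lemma extend_right (hI : I.OrdConnected) (hI' : IsClosed I) {u : ℝ → ℝ} (hu : ContinuousOn u I)
    (a : ℝ) (c : EReal) (hc : c < extend I u a) : ∀ᶠ z in 𝓝[>] a, c < extend I u z := by
  by_cases ha : a ∈ I
  · rw [extend_of_mem ha] at hc
    have h1 : Tendsto (fun z => (u z : EReal)) (𝓝[I] a) (𝓝 (u a)) :=
      (continuous_coe_real_ereal.tendsto _).comp (hu a ha)
    have h2 := eventually_nhdsWithin_iff.1 (h1.eventually_const_lt hc)
    filter_upwards [h2.filter_mono nhdsWithin_le_nhds, self_mem_nhdsWithin] with z hz haz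
    by_cases hzI : z ∈ I
    · rw [extend_of_mem hzI]; exact hz hzI
    · rw [extend_of_gt hI hzI ha haz]; exact lt_top_of_lt hc
  · have hop : ∀ᶠ z in 𝓝 a, z ∉ I := hI'.isOpen_compl.mem_nhds ha
    by_cases hy : ∃ y ∈ I, a < y
    · obtain ⟨y, hy, hay⟩ := hy
      rw [extend_of_lt ha hy hay] at hc
      exact absurd hc not_lt_bot
    · have hc' : c < ⊤ := lt_top_of_lt hc
      filter_upwards [hop.filter_mono nhdsWithin_le_nhds, self_mem_nhdsWithin] with z hz haz
      rw [extend, if_neg hz, if_neg]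
      · exact hc'
      · rintro ⟨y, hyI, hzy⟩
        exact hy ⟨y, hyI, lt_trans haz hzy⟩

lemma extend_left (hI : I.OrdConnected) (hI' : IsClosed I) (hne : I.Nonempty) {u : ℝ → ℝ}
    (hu : ContinuousOn u I) (a : ℝ) (c : EReal) (hc : extend I u a < c) :
    ∀ᶠ z in 𝓝[<] a, extend I u z < c := by
  have h1 : -c < extend (sflip I) (rflip u) (-a) := by
    rw [extend_flip hI hne, flip, neg_neg]
    exact EReal.neg_lt_neg_iff.2 hc
  have h2 := extend_right (hI.preimage_anti fun _ _ => neg_le_neg)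
    (hI'.preimage continuous_neg) (continuousOn_rflip hu) _ _ h1
  filter_upwards [(tendsto_neg_left a).eventually h2] with z hz
  have hz : -c < extend (sflip I) (rflip u) (-z) := hz
  rw [extend_flip hI hne, flip, neg_neg] at hz
  exact EReal.neg_lt_neg_iff.1 hz

lemma InitialData.admissible (h : InitialData I v₀ w₀) :
    Admissible (extend I v₀) (extend I w₀) where
  meas_f := measurable_extend h.isClosed h.cont_v
  meas_g := measurable_extend h.isClosed h.cont_w
  le z := by
    by_cases hz : z ∈ I
    · rw [extend_of_mem hz, extend_of_mem hz]
      exact_mod_cast h.le z hz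
    · simp [extend, hz]
  right_f := extend_right h.ordConnected h.isClosed h.cont_v
  right_g := extend_right h.ordConnected h.isClosed h.cont_w
  left_f := extend_left h.ordConnected h.isClosed ⟨_, (h.exists_ne 0).choose_spec.1⟩ h.cont_v
  left_g := extend_left h.ordConnected h.isClosed ⟨_, (h.exists_ne 0).choose_spec.1⟩ h.cont_w

/-! ### Lower semicontinuity of the right-moving field -/

lemma density_drop_left {f g : ℝ → EReal} {c c' z : ℝ} (hc : c ≤ c') (h : (c : EReal) < f z)
    (h' : f z ≤ c') : density f g c' z + 1 ≤ density f g c z := by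
  have hcc : (c : EReal) ≤ c' := by exact_mod_cast hc
  unfold density
  rw [if_pos h, if_neg (not_lt.2 h')]
  split_ifs with h1 h2 <;> norm_num
  exact h2 (hcc.trans_lt h1)

lemma density_drop_right {f g : ℝ → EReal} {c c' z : ℝ} (hc : c ≤ c') (h : (c : EReal) < g z)
    (h' : g z ≤ c') : density f g c' z + 1 ≤ density f g c z := by
  have := density_drop_left (g := f) hc h h'
  unfold density at this ⊢
  linarith

lemma forall_le_or_forall_ge {u : ℝ → ℝ} {J : Set ℝ} (hJ : IsPreconnected J)
    (hu : ContinuousOn u J) {c c' : ℝ} (hc : c < c') (h : ∀ z ∈ J, c < u z → c' ≤ u z) :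
    (∀ z ∈ J, u z ≤ c) ∨ ∀ z ∈ J, c' ≤ u z := by
  by_contra! hcon
  obtain ⟨⟨p, hp, hp'⟩, q, hq, hq'⟩ := hcon
  obtain ⟨m, hm, hm'⟩ := exists_between hc
  have hq'' : u q ≤ c := by
    by_contra! hlt
    exact absurd (h q hq hlt) (not_le.2 hq')
  obtain ⟨z, hz, hzm⟩ := hJ.intermediate_value hq hp hu
    (show m ∈ Icc (u q) (u p) from ⟨hq''.trans hm.le, hm'.le.trans (h p hp hp')⟩)
  exact absurd (h z hz (hzm ▸ hm)) (not_le.2 (hzm ▸ hm'))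

/-- Upgrades one intermediate value to an interval of positive length, as needed for a drop of the
gain. Since `z` may be an end of `I`, the interval is taken to the right of `z` if `z < m` and to
its left otherwise. -/
lemma exists_interval_of_mem_Ioo (hI : I.OrdConnected) {u : ℝ → ℝ} (hu : ContinuousOn u I)
    {a x m y z c c' : ℝ} (hx : x ∈ I) (hm : m ∈ I) (hax : a ≤ x) (hxm : x < m) (hz : z ∈ I)
    (haz : a ≤ z) (hzy : z < y) (hc : c < u z) (hc' : u z < c') :
    ∃ p q, a ≤ p ∧ p < q ∧ q ≤ y ∧ ∀ z' ∈ Ioo p q, z' ∈ I ∧ c < u z' ∧ u z' < c' := by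
  have hev : ∀ᶠ z' in 𝓝[I] z, c < u z' ∧ u z' < c' :=
    ((hu z hz).eventually_const_lt hc).and ((hu z hz).eventually_lt_const hc')
  obtain ⟨δ, hδ, hball⟩ := Metric.mem_nhdsWithin_iff.1 hev
  have key : ∀ z' ∈ I, |z' - z| < δ → c < u z' ∧ u z' < c' := fun z' h1 h2 =>
    hball ⟨by rwa [Metric.mem_ball, Real.dist_eq], h1⟩
  rcases lt_or_ge z m with hzm | hzm
  · refine ⟨z, min (z + δ) (min y m), haz, lt_min (by linarith) (lt_min hzy hzm),
      (min_le_right _ _).trans (min_le_left _ _), fun z' hz' => ?_⟩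
    have h1 : z' < z + δ := hz'.2.trans_le (min_le_left _ _)
    have h2 : z' < m := hz'.2.trans_le ((min_le_right _ _).trans (min_le_right _ _))
    have h3 : z' ∈ I := hI.out hz hm ⟨hz'.1.le, h2.le⟩
    exact ⟨h3, key z' h3 (by rw [abs_lt]; constructor <;> linarith [hz'.1])⟩
  · refine ⟨max x (z - δ), z, hax.trans (le_max_left _ _), max_lt (by linarith) (by linarith),
      hzy.le, fun z' hz' => ?_⟩
    have h1 : z - δ < z' := (le_max_right _ _).trans_lt hz'.1
    have h2 : x < z' := (le_max_left _ _).trans_lt hz'.1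
    have h3 : z' ∈ I := hI.out hx hz ⟨h2.le, hz'.2.le⟩
    exact ⟨h3, key z' h3 (by rw [abs_lt]; constructor <;> linarith [hz'.2])⟩

lemma tendsto_sub_nhds (x t : ℝ) :
    Tendsto (fun z : ℝ × ℝ => z.1 - z.2) (𝓝 (x, t)) (𝓝 (x - t)) :=
  (continuous_fst.sub continuous_snd).tendsto (x, t)

lemma tendsto_add_nhds (x t : ℝ) :
    Tendsto (fun z : ℝ × ℝ => z.1 + z.2) (𝓝 (x, t)) (𝓝 (x + t)) :=
  (continuous_fst.add continuous_snd).tendsto (x, t)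

namespace InitialData

variable (h : InitialData I v₀ w₀)
include h

lemma left_wall {l : ℝ} (hl : l ∈ I) (hmin : ∀ y ∈ I, l ≤ y) : w₀ l = v₀ l :=
  (h.bdry l ((h.mem_frontier_iff hl).2 (Or.inr hmin))).symm

lemma right_wall {l : ℝ} (hl : l ∈ I) (hmax : ∀ y ∈ I, y ≤ l) : v₀ l = w₀ l :=
  h.bdry l ((h.mem_frontier_iff hl).2 (Or.inl hmax))

/-- Points whose left characteristic leaves `I`: the level `c` is attained after reflection at the
left end `l`. -/
lemma eventually_le_upper_of_wall {x t l c : ℝ} (hmin : ∀ y ∈ I, l ≤ y)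
    (hg : ∀ᶠ y in 𝓝 (2 * l - (x - t)), ∀ z ∈ Ioo l y, c < extend I w₀ z) :
    ∀ᶠ z : ℝ × ℝ in 𝓝[I ×ˢ Ici 0] (x, t), z.1 - z.2 < l →
      (c : EReal) ≤ upper (extend I v₀) (extend I w₀) (z.1 - z.2) (z.1 + z.2) := by
  have hT : Tendsto (fun z : ℝ × ℝ => 2 * l - (z.1 - z.2)) (𝓝 (x, t)) (𝓝 (2 * l - (x - t))) :=
    (tendsto_sub_nhds x t).const_sub _
  filter_upwards [(hT.eventually hg).filter_mono nhdsWithin_le_nhds, self_mem_nhdsWithin]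
    with z hz hzI hlt
  exact le_upper_of_forall h.admissible hlt (by linarith [hmin _ hzI.1]) hz

/-- Nearby characteristics that start in `I` are covered by `le_upper`. Those that start outside
occur only if `x - t` is the left end; there `w₀ = v₀`, and the wall reflects the level. -/
lemma eventually_le_upper_of_mem {x t : ℝ} (ha : x - t ∈ I) {c : ℝ} (hc : c < v₀ (x - t)) :
    ∀ᶠ z : ℝ × ℝ in 𝓝[I ×ˢ Ici 0] (x, t),
      (c : EReal) ≤ upper (extend I v₀) (extend I w₀) (z.1 - z.2) (z.1 + z.2) := by
  have hev := eventually_nhdsWithin_iff.1 ((h.cont_v _ ha).eventually_const_lt hc)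
  have hev' := ((tendsto_sub_nhds x t).eventually hev).filter_mono
    (nhdsWithin_le_nhds (s := I ×ˢ Ici 0))
  have hin : ∀ᶠ z : ℝ × ℝ in 𝓝[I ×ˢ Ici 0] (x, t), z.1 - z.2 ∈ I →
      (c : EReal) ≤ upper (extend I v₀) (extend I w₀) (z.1 - z.2) (z.1 + z.2) := by
    filter_upwards [hev'] with z hz hzI
    refine le_trans ?_ (le_upper _ _)
    rw [extend_of_mem hzI]
    exact_mod_cast (hz hzI).le
  by_cases hmin : ∃ l ∈ I, l < x - t
  · obtain ⟨l, hl, hlt⟩ := hmin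
    have h1 := ((tendsto_sub_nhds x t).eventually_const_lt hlt).filter_mono
      (nhdsWithin_le_nhds (s := I ×ˢ Ici 0))
    filter_upwards [hin, h1, self_mem_nhdsWithin] with z hz hz1 hzI
    refine hz (h.ordConnected.out hl hzI.1 ⟨hz1.le, ?_⟩)
    have : (0 : ℝ) ≤ z.2 := hzI.2
    linarith
  · push Not at hmin
    have hg : (c : EReal) < extend I w₀ (x - t) := by
      rw [extend_of_mem ha, h.left_wall ha hmin]
      exact_mod_cast hc
    obtain ⟨u, hu, hu'⟩ := mem_nhdsGT_iff_exists_Ioc_subset.1 (h.admissible.right_g _ _ hg)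
    have hw := h.eventually_le_upper_of_wall (x := x) (t := t) hmin (c := c) (by
      have : 2 * (x - t) - (x - t) < u := by linarith [show x - t < u from hu]
      filter_upwards [gt_mem_nhds this] with y hy z hz
      exact hu' ⟨hz.1, hz.2.le.trans hy.le⟩)
    filter_upwards [hin, hw, self_mem_nhdsWithin] with z hz hz1 hzI
    by_cases hz2 : z.1 - z.2 ∈ I
    · exact hz hz2
    · have h0 : (0 : ℝ) ≤ z.2 := hzI.2
      obtain ⟨l, hl, hlt, -, hl'⟩ := h.exists_left hz2 hzI.1 (by linarith)
      exact hz1 (hlt.trans_le (hl' _ ha))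

lemma eventually_lt_upper {x t m : ℝ} (hx : x ∈ I) (hm : m ∈ I) (hxm : x < m) (ht : 0 ≤ t)
    {c : EReal} (hc : c < upper (extend I v₀) (extend I w₀) (x - t) (x + t)) :
    ∀ᶠ z : ℝ × ℝ in 𝓝[I ×ˢ Ici 0] (x, t),
      c < upper (extend I v₀) (extend I w₀) (z.1 - z.2) (z.1 + z.2) := by
  obtain ⟨r₁, hcr₁, hr₁⟩ := EReal.lt_iff_exists_real_btwn.1 hc
  obtain ⟨r₂, hcr₂, hr₂⟩ := EReal.lt_iff_exists_real_btwn.1 hcr₁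
  have hr : r₂ < r₁ := by exact_mod_cast hr₂
  suffices H : ∀ᶠ z : ℝ × ℝ in 𝓝[I ×ˢ Ici 0] (x, t),
      (r₂ : EReal) ≤ upper (extend I v₀) (extend I w₀) (z.1 - z.2) (z.1 + z.2) by
    filter_upwards [H] with z hz using hcr₂.trans_le hz
  have hA := h.admissible
  by_cases hcase : x - t ∈ I ∧ r₂ < v₀ (x - t)
  · exact h.eventually_le_upper_of_mem hcase.1 hcase.2
  have ht' : 0 < t := by
    rcases ht.eq_or_lt with rfl | ht'
    · simp only [sub_zero, add_zero, upper_self, extend_of_mem hx] at hr₁ hcase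
      exact absurd ⟨hx, hr.trans (by exact_mod_cast hr₁)⟩ hcase
    · exact ht'
  set a := x - t with ha
  obtain ⟨y, hy, hgy⟩ := exists_of_lt_upper hA (show a < x + t by linarith) hr₁
  have hax : a ≤ x := by linarith
  -- A strictly positive gain at the lower level `r₂` is stable under small changes of both
  -- endpoints.
  by_cases hpos : 0 < gain (extend I v₀) (extend I w₀) r₂ a y
  · set ε := gain (extend I v₀) (extend I w₀) r₂ a y with hε
    have e1 := (tendsto_sub_nhds x t).eventually (Metric.ball_mem_nhds a (show 0 < ε / 3 by linarith))
    have e2 := (tendsto_add_nhds x t).eventually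
      (Metric.ball_mem_nhds (x + t) (show 0 < ε / 3 by linarith))
    have e3 := (tendsto_sub_nhds x t).eventually_lt_const (show x - t < y from hy.1)
    have e4 : ∀ᶠ z : ℝ × ℝ in 𝓝 (x, t), z.1 - z.2 < z.1 + z.2 :=
      (tendsto_sub_nhds x t).eventually_lt (tendsto_add_nhds x t) (by linarith)
    refine Eventually.filter_mono nhdsWithin_le_nhds ?_
    filter_upwards [e1, e2, e3, e4] with z h1 h2 h3 h4
    rw [Real.dist_eq] at h1 h2
    refine le_upper_of_gain (y := min y (z.1 + z.2)) ⟨lt_min h3 h4, min_le_right _ _⟩ ?_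
    rw [← hA.gain_add r₂ (z.1 - z.2) a, ← hA.gain_add r₂ a y, ← hε]
    have g1 := (abs_le.1 (abs_gain_le (f := extend I v₀) (g := extend I w₀) r₂ (z.1 - z.2) a)).1
    have g2 := (abs_le.1 (abs_gain_le (f := extend I v₀) (g := extend I w₀) r₂ y
      (min y (z.1 + z.2)))).1
    have g3 : |min y (z.1 + z.2) - y| < ε / 3 := by
      rcases le_total y (z.1 + z.2) with hle | hle
      · rw [min_eq_left hle, sub_self, abs_zero]; linarith
      · rw [min_eq_right hle, abs_lt]
        have := abs_lt.1 h2
        constructor <;> linarith [hy.2]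
    rw [abs_sub_comm] at h1
    linarith
  -- Otherwise the gains at `r₁` and `r₂` coincide, so no interval in `[a, y]` carries values of
  -- `v₀` or `w₀` strictly between `r₂` and `r₁`. By connectedness each function stays on one side
  -- of this gap.
  · have nodrop : ∀ p q, a ≤ p → p < q → q ≤ y → ¬ ∀ z ∈ Ioo p q,
        density (extend I v₀) (extend I w₀) r₁ z + 1 ≤
          density (extend I v₀) (extend I w₀) r₂ z := fun p q hap hpq hqy hd =>
      hpos (hgy.trans_lt (hA.gain_lt_of_drop hr.le hap hpq hqy hd))
    set J := I ∩ Ico a y with hJ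
    have hJc : IsPreconnected J := (h.ordConnected.inter ordConnected_Ico).isPreconnected
    have hv : (∀ z ∈ J, v₀ z ≤ r₂) ∨ ∀ z ∈ J, r₁ ≤ v₀ z := by
      refine forall_le_or_forall_ge hJc (h.cont_v.mono inter_subset_left) hr fun z hz hlt => ?_
      by_contra! hlt'
      obtain ⟨p, q, hap, hpq, hqy, hd⟩ := exists_interval_of_mem_Ioo h.ordConnected h.cont_v hx hm
        hax hxm hz.1 hz.2.1 hz.2.2 hlt hlt'
      refine nodrop p q hap hpq hqy fun z hz => density_drop_left hr.le ?_ ?_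
      · rw [extend_of_mem (hd z hz).1]; exact_mod_cast (hd z hz).2.1
      · rw [extend_of_mem (hd z hz).1]; exact_mod_cast (hd z hz).2.2.le
    have hw : (∀ z ∈ J, w₀ z ≤ r₂) ∨ ∀ z ∈ J, r₁ ≤ w₀ z := by
      refine forall_le_or_forall_ge hJc (h.cont_w.mono inter_subset_left) hr fun z hz hlt => ?_
      by_contra! hlt'
      obtain ⟨p, q, hap, hpq, hqy, hd⟩ := exists_interval_of_mem_Ioo h.ordConnected h.cont_w hx hm
        hax hxm hz.1 hz.2.1 hz.2.2 hlt hlt'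
      refine nodrop p q hap hpq hqy fun z hz => density_drop_right hr.le ?_ ?_
      · rw [extend_of_mem (hd z hz).1]; exact_mod_cast (hd z hz).2.1
      · rw [extend_of_mem (hd z hz).1]; exact_mod_cast (hd z hz).2.2.le
    have hgy₂ : 0 ≤ gain (extend I v₀) (extend I w₀) r₂ a y :=
      hgy.trans (hA.gain_anti hr.le hy.1.le)
    -- If `v₀` stayed below the gap, the density would be `-1` on more than half of `[a, y]`: `m`
    -- exceeds the midpoint `x`.
    have hexcl : ¬ ∀ z ∈ J, v₀ z ≤ r₂ := by
      intro hall
      refine absurd hgy₂ (not_le.2 (hA.gain_neg (m := min y m) hy.1 (lt_min hy.1 (by linarith)) ?_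
        fun z hz => ?_))
      · rcases le_total y m with hle | hle
        · rw [min_eq_left hle]; linarith [hy.1]
        · rw [min_eq_right hle]; linarith [hy.2]
      · have hzy := hz.2.trans_le (min_le_left _ _)
        have hzm := hz.2.trans_le (min_le_right _ _)
        by_cases hzI : z ∈ I
        · rw [extend_of_mem hzI]
          exact_mod_cast hall z ⟨hzI, hz.1.le, hzy⟩
        · rw [extend_of_lt hzI hm hzm]; exact bot_le
    have hv' := hv.resolve_left hexcl
    have haI : a ∉ I := fun haI => hcase ⟨haI, hr.trans_le (hv' a ⟨haI, le_rfl, hy.1⟩)⟩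
    obtain ⟨l, hl, hal, hlx, hmin⟩ := h.exists_left haI hx hax
    have hly : l < y := by
      by_contra! hle
      exact hexcl fun z hz => absurd (hmin z hz.1) (not_le.2 (hz.2.2.trans_le hle))
    -- The wall condition `w₀ l = v₀ l` places `w₀` on the same side of the gap as `v₀`.
    have hw' : ∀ z ∈ J, r₁ ≤ w₀ z := hw.resolve_left fun hall => by
      have h1 := hall l ⟨hl, hal.le, hly⟩
      rw [h.left_wall hl hmin] at h1
      linarith [hv' l ⟨hl, hal.le, hly⟩]
    have hg1 : ∀ z ∈ Ioo l y, (r₁ : EReal) ≤ extend I w₀ z := by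
      intro z hz
      by_cases hzI : z ∈ I
      · rw [extend_of_mem hzI]
        exact_mod_cast hw' z ⟨hzI, (hal.trans hz.1).le, hz.2⟩
      · rw [extend_of_gt h.ordConnected hzI hl hz.1]; exact le_top
    have hgy1 : (r₁ : EReal) ≤ extend I w₀ y := by
      by_contra! hlt
      have h1 := hA.left_g y _ hlt
      have h2 : ∀ᶠ z in 𝓝[<] y, z ∈ Ioo l y := Ioo_mem_nhdsLT hly
      obtain ⟨z, hz, hz'⟩ := (h1.and h2).exists
      exact absurd (hg1 z hz') (not_le.2 hz)
    obtain ⟨u, hu, hu'⟩ := mem_nhdsGT_iff_exists_Ioc_subset.1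
      (hA.right_g y _ (hr₂.trans_le hgy1))
    have hyu : y < u := hu
    have hgu : ∀ z ∈ Ioo l u, (r₂ : EReal) < extend I w₀ z := by
      intro z hz
      rcases lt_trichotomy z y with hlt | rfl | hlt
      · exact hr₂.trans_le (hg1 z ⟨hz.1, hlt⟩)
      · exact hr₂.trans_le hgy1
      · exact hu' ⟨hlt, hz.2.le⟩
    -- The loss `l - a` to the left of the wall must be made up on `[l, y]`, so `y` lies at or
    -- beyond the mirror image of `a`.
    have hly2 : 2 * l - a ≤ y := by
      have e1 := hA.gain_of_le (c := r₂) hal.le (fun z hz => by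
        rw [extend_of_lt (fun hzI => absurd (hmin z hzI) (not_le.2 hz.2)) hl hz.2]
        exact bot_le)
      have e2 := gain_le (extend I v₀) (extend I w₀) r₂ hly.le
      rw [← hA.gain_add r₂ a l, e1] at hgy₂
      linarith
    have hwall := h.eventually_le_upper_of_wall (x := x) (t := t) hmin (c := r₂) (by
      filter_upwards [gt_mem_nhds (hly2.trans_lt hyu)] with y' hy' z hz
      exact hgu z ⟨hz.1, hz.2.trans hy'⟩)
    have hlt := ((tendsto_sub_nhds x t).eventually_lt_const hal).filter_mono
      (nhdsWithin_le_nhds (s := I ×ˢ Ici 0))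
    filter_upwards [hwall, hlt] with z hz hz'
    exact hz hz'

end InitialData

/-! ### The real-valued fields: boundary condition and continuity -/

/-- The extended-valued right-moving field. -/
noncomputable def upperField (I : Set ℝ) (v₀ w₀ : ℝ → ℝ) (x t : ℝ) : EReal :=
  upper (extend I v₀) (extend I w₀) (x - t) (x + t)

/-- The extended-valued left-moving field. -/
noncomputable def lowerField (I : Set ℝ) (v₀ w₀ : ℝ → ℝ) (x t : ℝ) : EReal :=
  lower (extend I v₀) (extend I w₀) (x - t) (x + t)

open Classical in
/-- The right-moving field; at the right end of `I` it is given by reflection. -/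
noncomputable def vSol (I : Set ℝ) (v₀ w₀ : ℝ → ℝ) (x t : ℝ) : ℝ :=
  if ∀ y ∈ I, y ≤ x then (lowerField I v₀ w₀ x t).toReal else (upperField I v₀ w₀ x t).toReal

/-- The left-moving field. -/
noncomputable def wSol (I : Set ℝ) (v₀ w₀ : ℝ → ℝ) (x t : ℝ) : ℝ :=
  -vSol (sflip I) (rflip w₀) (rflip v₀) (-x) t

lemma wSol_flip (x t : ℝ) :
    wSol (sflip I) (rflip w₀) (rflip v₀) x t = -vSol I v₀ w₀ (-x) t := by
  simp [wSol, sflip_sflip, rflip_rflip]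

lemma vSol_flip (x t : ℝ) :
    vSol (sflip I) (rflip w₀) (rflip v₀) x t = -wSol I v₀ w₀ (-x) t := by
  simp [wSol]

lemma mem_sflip {x : ℝ} : x ∈ sflip I ↔ -x ∈ I := Iff.rfl

lemma vSol_of_lt {x t m : ℝ} (hm : m ∈ I) (hxm : x < m) :
    vSol I v₀ w₀ x t = (upperField I v₀ w₀ x t).toReal :=
  if_neg fun hle => absurd (hle m hm) (not_le.2 hxm)

lemma tendsto_neg_fst (x t : ℝ) : Tendsto (fun z : ℝ × ℝ => (-z.1, z.2)) (𝓝[I ×ˢ Ici 0] (x, t))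
    (𝓝[sflip I ×ˢ Ici 0] (-x, t)) := by
  refine tendsto_nhdsWithin_iff.2 ⟨?_, ?_⟩
  · exact ((continuous_fst.neg.prodMk continuous_snd).tendsto (x, t)).mono_left nhdsWithin_le_nhds
  · filter_upwards [self_mem_nhdsWithin] with z hz
    exact ⟨by simpa [mem_sflip] using hz.1, hz.2⟩

namespace InitialData

variable (h : InitialData I v₀ w₀)
include h

lemma nonempty : I.Nonempty := ⟨_, (h.exists_ne 0).choose_spec.1⟩

lemma upperField_flip (x t : ℝ) :
    upperField (sflip I) (rflip w₀) (rflip v₀) x t = -lowerField I v₀ w₀ (-x) t := by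
  rw [upperField, lowerField, extend_flip h.ordConnected h.nonempty,
    extend_flip h.ordConnected h.nonempty, ← upper_flip]
  congr 1 <;> ring

lemma lowerField_eq (x t : ℝ) :
    lowerField I v₀ w₀ x t = -upperField (sflip I) (rflip w₀) (rflip v₀) (-x) t := by
  rw [h.upperField_flip]; simp

lemma lowerField_le_upperField {x t : ℝ} (ht : 0 ≤ t) :
    lowerField I v₀ w₀ x t ≤ upperField I v₀ w₀ x t :=
  lower_le_upper h.admissible (by linarith)

lemma wSol_of_gt {x t m : ℝ} (hm : m ∈ I) (hxm : m < x) :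
    wSol I v₀ w₀ x t = (lowerField I v₀ w₀ x t).toReal := by
  rw [wSol, vSol_of_lt (m := -m) (by simpa [mem_sflip] using hm) (neg_lt_neg hxm),
    h.upperField_flip]
  simp

lemma vSol_of_max {x t : ℝ} (hx : ∀ y ∈ I, y ≤ x) :
    vSol I v₀ w₀ x t = wSol I v₀ w₀ x t := by
  obtain ⟨m, hm, hmx⟩ := h.not_min_of_max hx
  rw [h.wSol_of_gt hm hmx, vSol, if_pos hx]

/-- A point `m` of `I` beyond `x` is essential: at the right end and `t > 0` the wall compensates
every loss, and the formula returns `⊤`. -/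
lemma upperField_lt_top {x t m : ℝ} (hm : m ∈ I) (hxm : x < m) (ht : 0 ≤ t) :
    upperField I v₀ w₀ x t < ⊤ := by
  have hK : IsCompact (I ∩ Icc (x - t) m) := isCompact_Icc.inter_left h.isClosed
  obtain ⟨c, hc⟩ := hK.bddAbove_image (h.cont_v.mono inter_subset_left)
  refine (upper_le_of_forall (c := c) (m := m) h.admissible (by linarith) (by linarith)
    fun z hz => ?_).trans_lt (EReal.coe_lt_top c)
  by_cases hzI : z ∈ I
  · rw [extend_of_mem hzI]
    exact_mod_cast hc (mem_image_of_mem _ ⟨hzI, hz.1, hz.2.le⟩)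
  · rw [extend_of_lt hzI hm hz.2]; exact bot_le

lemma bot_lt_upperField {x t : ℝ} (hx : x ∈ I) (ht : 0 ≤ t) : ⊥ < upperField I v₀ w₀ x t := by
  by_cases ha : x - t ∈ I
  · refine lt_of_lt_of_le ?_ (le_upper _ _)
    rw [extend_of_mem ha]; exact EReal.bot_lt_coe _
  · obtain ⟨l, hl, hal, hlx, hmin⟩ := h.exists_left ha hx (by linarith)
    have hK : IsCompact (I ∩ Icc l (2 * l - (x - t))) := isCompact_Icc.inter_left h.isClosed
    obtain ⟨c, hc⟩ := hK.bddBelow_image (h.cont_w.mono inter_subset_left)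
    refine (EReal.bot_lt_coe (c - 1)).trans_le (le_upper_of_forall (l := l) h.admissible hal
      (by linarith) fun z hz => ?_)
    by_cases hzI : z ∈ I
    · rw [extend_of_mem hzI]
      have : c ≤ w₀ z := hc (mem_image_of_mem _ ⟨hzI, hz.1.le, hz.2.le⟩)
      exact_mod_cast (by linarith : c - 1 < w₀ z)
    · rw [extend_of_gt h.ordConnected hzI hl hz.1]; exact EReal.coe_lt_top _

lemma coe_vSol {x t m : ℝ} (hx : x ∈ I) (hm : m ∈ I) (hxm : x < m) (ht : 0 ≤ t) :
    (vSol I v₀ w₀ x t : EReal) = upperField I v₀ w₀ x t := by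
  rw [vSol_of_lt hm hxm, EReal.coe_toReal (h.upperField_lt_top hm hxm ht).ne
    (h.bot_lt_upperField hx ht).ne']

lemma coe_wSol {x t m : ℝ} (hx : x ∈ I) (hm : m ∈ I) (hmx : m < x) (ht : 0 ≤ t) :
    (wSol I v₀ w₀ x t : EReal) = lowerField I v₀ w₀ x t := by
  have := h.flip.coe_vSol (x := -x) (m := -m) (by simpa [mem_sflip] using hx)
    (by simpa [mem_sflip] using hm) (neg_lt_neg hmx) ht
  rw [h.lowerField_eq, ← this, wSol]
  simp

lemma vSol_of_min {x t : ℝ} (hx : ∀ y ∈ I, x ≤ y) :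
    vSol I v₀ w₀ x t = wSol I v₀ w₀ x t := by
  have := h.flip.vSol_of_max (x := -x) (t := t) fun y hy => by linarith [hx _ hy]
  rw [wSol_flip, vSol_flip] at this
  simpa using this.symm

lemma wSol_le_vSol {x t : ℝ} (hx : x ∈ I) (ht : 0 ≤ t) :
    wSol I v₀ w₀ x t ≤ vSol I v₀ w₀ x t := by
  by_cases hmax : ∀ y ∈ I, y ≤ x
  · exact (h.vSol_of_max hmax).ge
  by_cases hmin : ∀ y ∈ I, x ≤ y
  · exact (h.vSol_of_min hmin).ge
  push Not at hmax hmin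
  obtain ⟨m, hm, hxm⟩ := hmax
  obtain ⟨l, hl, hlx⟩ := hmin
  have := h.lowerField_le_upperField (x := x) ht
  rw [← h.coe_vSol hx hm hxm ht, ← h.coe_wSol hx hl hlx ht] at this
  exact_mod_cast this

lemma vSol_zero {x : ℝ} (hx : x ∈ I) : vSol I v₀ w₀ x 0 = v₀ x := by
  by_cases hmax : ∀ y ∈ I, y ≤ x
  · obtain ⟨l, hl, hlx⟩ := h.not_min_of_max hmax
    rw [h.vSol_of_max hmax, h.wSol_of_gt hl hlx, h.right_wall hx hmax]
    simp [lowerField, lower_self, extend_of_mem hx]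
  · push Not at hmax
    obtain ⟨m, hm, hxm⟩ := hmax
    rw [vSol_of_lt hm hxm]
    simp [upperField, upper_self, extend_of_mem hx]

lemma wSol_zero {x : ℝ} (hx : x ∈ I) : wSol I v₀ w₀ x 0 = w₀ x := by
  rw [wSol, h.flip.vSol_zero (by simpa [mem_sflip] using hx)]
  simp [rflip]

lemma continuousWithinAt_upperField {x t m : ℝ} (hx : x ∈ I) (hm : m ∈ I) (hxm : x < m)
    (ht : 0 ≤ t) : ContinuousWithinAt (fun z : ℝ × ℝ => upperField I v₀ w₀ z.1 z.2)
      (I ×ˢ Ici 0) (x, t) := by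
  refine tendsto_order.2 ⟨fun c hc => h.eventually_lt_upper hx hm hxm ht hc, fun c hc => ?_⟩
  have hf : ∀ c, extend I v₀ (x - t) < c → ∀ᶠ z in 𝓝 (x - t), extend I v₀ z < c := by
    intro c hc
    have hlt : ∀ᶠ z in 𝓝 (x - t), z < m := gt_mem_nhds (by linarith)
    have hin : ∀ᶠ z in 𝓝 (x - t), z ∈ I → extend I v₀ z < c := by
      by_cases ha : x - t ∈ I
      · rw [extend_of_mem ha] at hc
        have h1 : Tendsto (fun z => (v₀ z : EReal)) (𝓝[I] (x - t)) (𝓝 (v₀ (x - t))) :=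
          (continuous_coe_real_ereal.tendsto _).comp (h.cont_v _ ha)
        filter_upwards [eventually_nhdsWithin_iff.1 (h1.eventually_lt_const hc)] with z hz hzI
        rw [extend_of_mem hzI]; exact hz hzI
      · filter_upwards [h.isClosed.isOpen_compl.mem_nhds ha] with z hz hzI using absurd hzI hz
    filter_upwards [hlt, hin] with z hz hz'
    by_cases hzI : z ∈ I
    · exact hz' hzI
    · rw [extend_of_lt hzI hm hz]; exact bot_lt_of_lt hc
  have hT : Tendsto (fun z : ℝ × ℝ => (z.1 - z.2, z.1 + z.2)) (𝓝 (x, t)) (𝓝 (x - t, x + t)) :=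
    (tendsto_sub_nhds x t).prodMk_nhds (tendsto_add_nhds x t)
  exact (hT.eventually (eventually_upper_lt h.admissible hf hc)).filter_mono nhdsWithin_le_nhds

lemma continuousWithinAt_vSol_of_lt {x t m : ℝ} (hx : x ∈ I) (hm : m ∈ I) (hxm : x < m)
    (ht : 0 ≤ t) : ContinuousWithinAt (fun z : ℝ × ℝ => vSol I v₀ w₀ z.1 z.2)
      (I ×ˢ Ici 0) (x, t) := by
  have h1 := (EReal.tendsto_toReal (h.upperField_lt_top hm hxm ht).ne
    (h.bot_lt_upperField hx ht).ne').comp (h.continuousWithinAt_upperField hx hm hxm ht)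
  have h2 : ∀ᶠ z : ℝ × ℝ in 𝓝 (x, t), z.1 < m :=
    (continuous_fst.tendsto (x, t)).eventually_lt_const hxm
  refine ContinuousWithinAt.congr_of_eventuallyEq h1 ?_ (vSol_of_lt hm hxm)
  filter_upwards [h2.filter_mono nhdsWithin_le_nhds] with z hz
  exact vSol_of_lt hm hz

lemma continuousWithinAt_wSol_of_gt {x t m : ℝ} (hx : x ∈ I) (hm : m ∈ I) (hmx : m < x)
    (ht : 0 ≤ t) : ContinuousWithinAt (fun z : ℝ × ℝ => wSol I v₀ w₀ z.1 z.2)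
      (I ×ˢ Ici 0) (x, t) := by
  have h1 := h.flip.continuousWithinAt_vSol_of_lt (x := -x) (m := -m)
    (by simpa [mem_sflip] using hx) (by simpa [mem_sflip] using hm) (neg_lt_neg hmx) ht
  exact (h1.tendsto.comp (tendsto_neg_fst x t)).neg

/-- At the right end, a bound on the left-moving field bounds the right-moving field nearby. -/
lemma eventually_upperField_lt_of_max {x t : ℝ} (hx : x ∈ I) (hmax : ∀ y ∈ I, y ≤ x) (ht : 0 ≤ t)
    {c : ℝ} (hc : lowerField I v₀ w₀ x t < c) :
    ∀ᶠ z : ℝ × ℝ in 𝓝[I ×ˢ Ici 0] (x, t), z.1 < x → upperField I v₀ w₀ z.1 z.2 ≤ c := by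
  have hA := h.admissible
  obtain ⟨r, hr, hrc⟩ := EReal.lt_iff_exists_real_btwn.1 hc
  -- The right wall contributes the full gain `t`, so a nonpositive total requires density `-1`
  -- almost everywhere on `[x - t, x]`. A point with `f z > r` would spoil this on a whole interval.
  have hle : ∀ z ∈ Ioo (x - t) x, extend I v₀ z ≤ r := by
    intro z hz
    by_contra! hlt
    obtain ⟨u, hu, hu'⟩ := mem_nhdsGT_iff_exists_Ioc_subset.1 (hA.right_f z _ hlt)
    obtain ⟨y, hy, hgy⟩ := exists_of_lower_lt hA (by linarith [hz.1, hz.2]) hr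
    have hxt : gain (extend I v₀) (extend I w₀) r x (x + t) = t := by
      rw [hA.gain_of_lt (by linarith) fun z hz => by
        rw [extend_of_gt h.ordConnected (fun hzI => absurd (hmax z hzI) (not_le.2 hz.1)) hx hz.1]
        exact EReal.coe_lt_top r]
      ring
    have hyx : y < x := by
      by_contra! hxy
      have e1 := hA.gain_add r x y (x + t)
      have e2 := gain_le (extend I v₀) (extend I w₀) r hxy
      linarith [hy.2]
    have hyz : y ≤ z := by
      by_contra! hzy
      have e1 := hA.gain_add r y x (x + t)
      have e2 := le_gain (extend I v₀) (extend I w₀) r hyx.le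
      linarith [hy.1, hz.1]
    set q := min u x
    have hzq : z < q := lt_min hu hz.2
    have e0 : 0 ≤ gain (extend I v₀) (extend I w₀) r z q :=
      hA.gain_nonneg hzq.le fun z' hz' => hu' ⟨hz'.1, hz'.2.le.trans (min_le_left _ _)⟩
    have e1 := le_gain (extend I v₀) (extend I w₀) r hyz
    have e2 := le_gain (extend I v₀) (extend I w₀) r (min_le_right u x : q ≤ x)
    have e3 := hA.gain_add r y z q
    have e4 := hA.gain_add r y q x
    have e5 := hA.gain_add r y x (x + t)
    linarith [hy.1]
  have hend : extend I v₀ (x - t) ≤ r := by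
    by_contra! hlt
    rcases ht.eq_or_lt with rfl | ht'
    · simp only [lowerField, sub_zero, add_zero, lower_self, extend_of_mem hx] at hr hlt
      rw [← h.right_wall hx hmax] at hr
      exact lt_asymm hr hlt
    · obtain ⟨z, hz, hz'⟩ := ((hA.right_f _ _ hlt).and (Ioo_mem_nhdsGT
        (show x - t < x by linarith))).exists
      exact absurd (hle z hz') (not_le.2 hz)
  obtain ⟨u, hu, hu'⟩ := mem_nhdsLT_iff_exists_Ico_subset.1
    (hA.left_f _ _ (hend.trans_lt hrc))
  have hux : u < x - t := hu
  have hall : ∀ z ∈ Ioo u x, extend I v₀ z ≤ c := by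
    intro z hz
    rcases lt_trichotomy z (x - t) with hlt | rfl | hlt
    · exact (show extend I v₀ z < c from hu' ⟨hz.1.le, hlt⟩).le
    · exact hend.trans hrc.le
    · exact (hle z ⟨hlt, hz.2⟩).trans hrc.le
  have h1 := ((tendsto_sub_nhds x t).eventually_const_lt hux).filter_mono
    (nhdsWithin_le_nhds (s := I ×ˢ Ici 0))
  filter_upwards [h1, self_mem_nhdsWithin] with z hz hzI hzx
  have h0 : (0 : ℝ) ≤ z.2 := hzI.2
  exact upper_le_of_forall hA (m := x) (by linarith) (by linarith)
    fun z' hz' => hall z' ⟨hz.trans_le hz'.1, hz'.2⟩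

/-- At the right end `v` is squeezed: from below by the continuous field `w ≤ v`, from above by
`eventually_upperField_lt_of_max`. -/
lemma continuousWithinAt_vSol {x t : ℝ} (hx : x ∈ I) (ht : 0 ≤ t) :
    ContinuousWithinAt (fun z : ℝ × ℝ => vSol I v₀ w₀ z.1 z.2) (I ×ˢ Ici 0) (x, t) := by
  by_cases hmax : ∀ y ∈ I, y ≤ x
  · obtain ⟨l, hl, hlx⟩ := h.not_min_of_max hmax
    have hw := h.continuousWithinAt_wSol_of_gt hx hl hlx ht
    refine tendsto_order.2 ⟨fun c hc => ?_, fun c hc => ?_⟩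
    · simp only [h.vSol_of_max hmax] at hc
      filter_upwards [hw.eventually_const_lt hc, self_mem_nhdsWithin] with z hz hzI
      exact hz.trans_le (h.wSol_le_vSol hzI.1 hzI.2)
    · simp only [h.vSol_of_max hmax] at hc
      obtain ⟨c', hc', hcc⟩ := exists_between hc
      have hL : lowerField I v₀ w₀ x t < c' := by
        rw [← h.coe_wSol hx hl hlx ht]; exact_mod_cast hc'
      filter_upwards [hw.eventually_lt_const hc, self_mem_nhdsWithin,
        h.eventually_upperField_lt_of_max hx hmax ht hL] with z hz hzI hU
      rcases (hmax _ hzI.1).eq_or_lt with heq | hlt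
      · rw [h.vSol_of_max (x := z.1) (fun y hy => heq ▸ hmax y hy)]
        exact hz
      · have := hU hlt
        rw [← h.coe_vSol hzI.1 hx hlt hzI.2] at this
        exact lt_of_le_of_lt (by exact_mod_cast this) hcc
  · push Not at hmax
    obtain ⟨m, hm, hxm⟩ := hmax
    exact h.continuousWithinAt_vSol_of_lt hx hm hxm ht

lemma continuousOn_vSol :
    ContinuousOn (fun z : ℝ × ℝ => vSol I v₀ w₀ z.1 z.2) (I ×ˢ Ici 0) :=
  fun _ hz => h.continuousWithinAt_vSol hz.1 hz.2

lemma continuousOn_wSol :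
    ContinuousOn (fun z : ℝ × ℝ => wSol I v₀ w₀ z.1 z.2) (I ×ˢ Ici 0) := by
  intro z hz
  have h1 := h.flip.continuousWithinAt_vSol (x := -z.1) (t := z.2)
    (by simpa [mem_sflip] using hz.1) hz.2
  exact (h1.tendsto.comp (tendsto_neg_fst z.1 z.2)).neg

end InitialData

/-! ### Transport in liquid and frozen regions -/

lemma eq_of_eventually_eq_right {φ : ℝ → ℝ} {a b : ℝ} (hab : a ≤ b) (hφ : ContinuousOn φ (Icc a b))
    (hloc : ∀ x ∈ Ico a b, ∀ᶠ y in 𝓝[≥] x, φ y = φ x) : φ b = φ a := by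
  refine constant_of_has_deriv_right_zero hφ (fun x hx => ?_) b ⟨hab, le_rfl⟩
  exact (hasDerivWithinAt_const x (Ici x) (φ x)).congr_of_eventuallyEq (hloc x hx) rfl

lemma upperField_mono {x t δ : ℝ} (hδ : 0 ≤ δ) :
    upperField I v₀ w₀ x t ≤ upperField I v₀ w₀ (x + δ) (t + δ) := by
  have : x + δ - (t + δ) = x - t := by ring
  rw [upperField, upperField, this]
  exact upper_mono (by linarith)

namespace InitialData

variable (h : InitialData I v₀ w₀)
include h

/-- `exists_le_lower` bounds the left-moving field only for `a'` strictly inside an interval;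
continuity along the left-moving characteristic closes the gap. The sign `σ = 1` approaches from
earlier times, `σ = -1` from later ones. -/
lemma le_wSol_of_eventually {x t l m c σ : ℝ} (hl : l ∈ I) (hm : m ∈ I) (hlx : l < x) (hxm : x < m)
    (ht : 0 ≤ t) (hlow : ∀ᶠ η in 𝓝[>] (0 : ℝ), 0 ≤ t - σ * η ∧
      (c : EReal) ≤ lower (extend I v₀) (extend I w₀) (x - t + 2 * (σ * η)) (x + t)) :
    c ≤ wSol I v₀ w₀ x t := by
  have hx : x ∈ I := h.ordConnected.out hl hm ⟨hlx.le, hxm.le⟩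
  have hφ : Tendsto (fun η : ℝ => (x + σ * η, t - σ * η)) (𝓝[>] 0) (𝓝 (x, t)) := by
    have : Continuous fun η : ℝ => (x + σ * η, t - σ * η) := by fun_prop
    simpa using (this.tendsto 0).mono_left nhdsWithin_le_nhds
  have h1 := ((continuous_fst.tendsto (x, t)).comp hφ).eventually_const_lt hlx
  have h2 := ((continuous_fst.tendsto (x, t)).comp hφ).eventually_lt_const hxm
  have hφ' : Tendsto (fun η : ℝ => (x + σ * η, t - σ * η)) (𝓝[>] 0) (𝓝[I ×ˢ Ici 0] (x, t)) := by
    refine tendsto_nhdsWithin_iff.2 ⟨hφ, ?_⟩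
    filter_upwards [h1, h2, hlow] with η hη1 hη2 hη3
    exact ⟨h.ordConnected.out hl hm ⟨hη1.le, hη2.le⟩, hη3.1⟩
  refine ge_of_tendsto ((h.continuousOn_wSol (x, t) ⟨hx, ht⟩).tendsto.comp hφ') ?_
  filter_upwards [h1, h2, hlow] with η hη1 hη2 hη3
  have hI : x + σ * η ∈ I := h.ordConnected.out hl hm ⟨hη1.le, hη2.le⟩
  have e := h.coe_wSol hI hl hη1 hη3.1
  have e' : (c : EReal) ≤ wSol I v₀ w₀ (x + σ * η) (t - σ * η) := by
    rw [e, lowerField]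
    convert hη3.2 using 2 <;> ring
  exact_mod_cast e'

lemma vSol_mono {x t δ m : ℝ} (hx : x ∈ I) (hm : m ∈ I) (hxm : x + δ < m) (ht : 0 ≤ t)
    (hδ : 0 ≤ δ) : vSol I v₀ w₀ x t ≤ vSol I v₀ w₀ (x + δ) (t + δ) := by
  have := upperField_mono (I := I) (v₀ := v₀) (w₀ := w₀) (x := x) (t := t) hδ
  rw [← h.coe_vSol hx hm (by linarith) ht, ← h.coe_vSol (h.ordConnected.out hx hm
    ⟨by linarith, hxm.le⟩) hm hxm (by linarith)] at this
  exact_mod_cast this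

/-- In a liquid region the right-moving field is constant along its characteristics. -/
lemma vSol_add_of_liquid {x t δ l m : ℝ} (hl : l ∈ I) (hm : m ∈ I) (hlx : l < x)
    (hxm : x + δ < m) (ht : 0 < t) (hδ : 0 ≤ δ)
    (hliq : ∀ β ∈ Icc 0 δ, wSol I v₀ w₀ (x + β) (t + β) < vSol I v₀ w₀ (x + β) (t + β)) :
    vSol I v₀ w₀ (x + δ) (t + δ) = vSol I v₀ w₀ x t := by
  have hIβ : ∀ β ∈ Icc 0 δ, x + β ∈ I := fun β hβ =>
    h.ordConnected.out hl hm ⟨by linarith [hβ.1], by linarith [hβ.2]⟩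
  have hx : x ∈ I := by simpa using hIβ 0 ⟨le_rfl, hδ⟩
  have hpath : ContinuousOn (fun β : ℝ => (x + β, t + β)) (Icc 0 δ) := by fun_prop
  have hmaps : MapsTo (fun β : ℝ => (x + β, t + β)) (Icc 0 δ) (I ×ˢ Ici 0) := fun β hβ =>
    ⟨hIβ β hβ, show (0 : ℝ) ≤ t + β by linarith [hβ.1]⟩
  have hcv : ContinuousOn (fun β => vSol I v₀ w₀ (x + β) (t + β)) (Icc 0 δ) :=
    h.continuousOn_vSol.comp hpath hmaps
  have hcw : ContinuousOn (fun β => wSol I v₀ w₀ (x + β) (t + β)) (Icc 0 δ) :=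
    h.continuousOn_wSol.comp hpath hmaps
  refine eq_of_eventually_eq_right (φ := fun β => vSol I v₀ w₀ (x + β) (t + β)) hδ hcv
    (fun β hβ => ?_) |>.trans (by simp)
  have hβ' : β ∈ Icc 0 δ := ⟨hβ.1, hβ.2.le⟩
  have hnear : ∀ᶠ γ in 𝓝[≥] β, γ ∈ Icc β δ := Icc_mem_nhdsGE hβ.2
  have hle : 𝓝[≥] β ≤ 𝓝[Icc 0 δ] β :=
    le_inf nhdsWithin_le_nhds (le_principal_iff.2 (mem_of_superset hnear
      fun γ hγ => ⟨hβ.1.trans hγ.1, hγ.2⟩))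
  have hlow := ((hcw β hβ').eventually_lt_const (hliq β hβ')).filter_mono hle
  -- Up to `u` the left-moving field stays below the value of `v` at parameter `β`. A rise of `v`
  -- before `u` would force it above that value.
  obtain ⟨u, hu, hu'⟩ := mem_nhdsGE_iff_exists_Icc_subset.1 (hlow.and hnear)
  refine mem_of_superset (Icc_mem_nhdsGE hu) fun γ hγ => ?_
  have hγδ := (hu' hγ).2.2
  have e1 : x + γ = x + β + (γ - β) := by ring
  have e2 : t + γ = t + β + (γ - β) := by ring
  have hmono : vSol I v₀ w₀ (x + β) (t + β) ≤ vSol I v₀ w₀ (x + γ) (t + γ) := by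
    rw [e1, e2]
    exact h.vSol_mono (hIβ β hβ') hm (by linarith) (by linarith [hβ.1]) (by linarith [hγ.1])
  refine (hmono.antisymm ?_).symm
  by_contra! hlt
  obtain ⟨c, hc, hc'⟩ := exists_between hlt
  have hcv1 : upper (extend I v₀) (extend I w₀) (x - t) (x + t + 2 * β) < c := by
    have : upperField I v₀ w₀ (x + β) (t + β) < c := by
      rw [← h.coe_vSol (hIβ β hβ') hm (by linarith [hβ.2]) (by linarith [hβ.1])]
      exact_mod_cast hc
    rw [upperField] at this
    convert this using 2 <;> ring
  have hcv2 : c < upper (extend I v₀) (extend I w₀) (x - t) (x + t + 2 * γ) := by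
    have : c < upperField I v₀ w₀ (x + γ) (t + γ) := by
      rw [← h.coe_vSol (hIβ γ ⟨hβ.1.trans hγ.1, hγδ⟩) hm (by linarith)
        (by linarith [hβ.1, hγ.1])]
      exact_mod_cast hc'
    rw [upperField] at this
    convert this using 2 <;> ring
  obtain ⟨y, hy, hya⟩ := exists_le_lower h.admissible (by linarith [hβ.1]) (by linarith [hγ.1])
    hcv1 hcv2
  obtain ⟨θ, rfl⟩ : ∃ θ, y = x + t + 2 * θ := ⟨(y - x - t) / 2, by ring⟩
  have hθ1 : β < θ := by linarith [hy.1]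
  have hθ2 : θ ≤ γ := by linarith [hy.2]
  have hwθ : wSol I v₀ w₀ (x + θ) (t + θ) < vSol I v₀ w₀ (x + β) (t + β) :=
    (hu' ⟨hθ1.le, hθ2.trans hγ.2⟩).1
  have : c ≤ wSol I v₀ w₀ (x + θ) (t + θ) := by
    refine h.le_wSol_of_eventually (σ := 1) hl hm (by linarith [hβ.1]) (by linarith)
      (by linarith [hβ.1]) ?_
    have hpos : 0 < t + θ := by linarith [hβ.1]
    filter_upwards [Ioo_mem_nhdsGT hpos] with η hη
    refine ⟨by linarith [hη.2], ?_⟩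
    convert hya (x - t + 2 * η) ⟨by linarith [hη.1], by linarith [hη.2]⟩ using 2 <;> ring
  linarith

/-- Growth through a level `c` is excluded by `not_upper_lt_lt_lower`, once `v₀ ≤ c` is known on the
stretch swept by the foot of the right-moving characteristic. -/
lemma vSol_le_of_frozen {x t t' l m : ℝ} (hl : l ∈ I) (hm : m ∈ I) (hlx : l < x - (t' - t))
    (hxm : x < m) (htt : t ≤ t') (htt' : t' ≤ 3 * t) (ht : 0 < t)
    (hfr : ∀ y ∈ Icc (x - (t' - t)) x, vSol I v₀ w₀ y t = wSol I v₀ w₀ y t)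
    (hfr' : vSol I v₀ w₀ x t' = wSol I v₀ w₀ x t') :
    vSol I v₀ w₀ x t' ≤ vSol I v₀ w₀ x t := by
  have hIn : ∀ y, l < y → y < m → y ∈ I := fun y h1 h2 => h.ordConnected.out hl hm ⟨h1.le, h2.le⟩
  have hx : x ∈ I := hIn x (by linarith) hxm
  by_contra! hlt
  obtain ⟨c, hc, hc'⟩ := exists_between hlt
  have hU : upper (extend I v₀) (extend I w₀) (x - t) (x + t) < c := by
    have := h.coe_vSol hx hm hxm ht.le
    rw [upperField] at this
    rw [← this]; exact_mod_cast hc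
  have hL : c < lower (extend I v₀) (extend I w₀) (x - t') (x + t') := by
    have := h.coe_wSol hx hl (by linarith) (ht.le.trans htt)
    rw [lowerField] at this
    rw [← this, ← hfr']; exact_mod_cast hc'
  refine absurd (not_upper_lt_lt_lower h.admissible ht htt (fun z hz => ?_) hU) (not_le.2 hL)
  obtain ⟨η, rfl⟩ : ∃ η, z = x - η - t := ⟨x - t - z, by ring⟩
  have hη : 0 < η := by linarith [hz.2]
  have hη' : η < t' - t := by linarith [hz.1]
  have hxη : x - η ∈ I := hIn _ (by linarith) (by linarith)
  have e : upperField I v₀ w₀ (x - η) t = lowerField I v₀ w₀ (x - η) t := by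
    rw [← h.coe_vSol hxη hm (by linarith) ht.le, ← h.coe_wSol hxη hl (by linarith) ht.le,
      hfr _ ⟨by linarith, by linarith⟩]
  -- Freezing at `(x - η, t)` allows switching from `upper` to `lower`, which is monotone in `a`.
  -- The point `(x - t, x - η + t)` has ordered coordinates because `η < t' - t ≤ 2 * t`; this is
  -- the origin of the bound `t' ≤ 3 * t`.
  calc extend I v₀ (x - η - t) ≤ upperField I v₀ w₀ (x - η) t := le_upper _ _
    _ = lower (extend I v₀) (extend I w₀) (x - η - t) (x - η + t) := e
    _ ≤ lower (extend I v₀) (extend I w₀) (x - t) (x - η + t) := lower_mono (by linarith)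
    _ ≤ upper (extend I v₀) (extend I w₀) (x - t) (x - η + t) :=
        lower_le_upper h.admissible (by linarith)
    _ ≤ upper (extend I v₀) (extend I w₀) (x - t) (x + t) := upper_mono (by linarith)
    _ ≤ c := hU.le

lemma exists_vSol_antitone_of_frozen {p q r s x t l m : ℝ}
    (hfr : ∀ y ∈ I ∩ Ioo p q, ∀ τ ∈ Ioo r s, vSol I v₀ w₀ y τ = wSol I v₀ w₀ y τ)
    (hl : l ∈ I) (hm : m ∈ I) (hlx : l < x) (hxm : x < m) (hx : x ∈ Ioo p q) (ht : t ∈ Ioo r s)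
    (ht0 : 0 < t) : ∃ ε > 0, ∀ τ τ', t - ε < τ → τ ≤ τ' → τ' < t + ε →
      vSol I v₀ w₀ x τ' ≤ vSol I v₀ w₀ x τ := by
  -- Times within `ε` of `t` satisfy `τ' ≤ 3 * τ` because `ε ≤ t / 2`. The halves of `x - p` and `x
  -- - l` keep `x - (τ' - τ)` to the right of `p` and `l`, as `τ' - τ < 2 * ε`.
  set ε := min (min (t - r) (s - t)) (min (t / 2) (min ((x - p) / 2) ((x - l) / 2))) with hε
  have h1 : ε ≤ t - r := (min_le_left _ _).trans (min_le_left _ _)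
  have h2 : ε ≤ s - t := (min_le_left _ _).trans (min_le_right _ _)
  have h3 : ε ≤ t / 2 := (min_le_right _ _).trans (min_le_left _ _)
  have h4 : ε ≤ (x - p) / 2 :=
    (min_le_right _ _).trans ((min_le_right _ _).trans (min_le_left _ _))
  have h5 : ε ≤ (x - l) / 2 :=
    (min_le_right _ _).trans ((min_le_right _ _).trans (min_le_right _ _))
  have hx1 := hx.1
  have hx2 := hx.2
  have ht1 := ht.1
  have ht2 := ht.2
  refine ⟨ε, ?_, fun τ τ' hτ hττ hτ' => ?_⟩
  · refine lt_min (lt_min ?_ ?_) (lt_min ?_ (lt_min ?_ ?_)) <;> linarith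
  refine h.vSol_le_of_frozen hl hm (by linarith) hxm hττ (by linarith) (by linarith)
    (fun y hy => hfr y ⟨h.ordConnected.out hl hm ⟨?_, ?_⟩, ?_, ?_⟩ τ ⟨?_, ?_⟩)
    (hfr x ⟨h.ordConnected.out hl hm ⟨hlx.le, hxm.le⟩, hx⟩ τ' ⟨?_, ?_⟩)
  all_goals first | linarith [hy.1, hy.2] | linarith

/-- Locally in time `v` is nonincreasing and, by reflection, `w` is nondecreasing; they coincide. -/
lemma vSol_eventually_eq_of_frozen {p q r s x t l m : ℝ}
    (hfr : ∀ y ∈ I ∩ Ioo p q, ∀ τ ∈ Ioo r s, vSol I v₀ w₀ y τ = wSol I v₀ w₀ y τ)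
    (hl : l ∈ I) (hm : m ∈ I) (hlx : l < x) (hxm : x < m) (hx : x ∈ Ioo p q) (ht : t ∈ Ioo r s)
    (ht0 : 0 < t) : ∀ᶠ τ in 𝓝[≥] t, vSol I v₀ w₀ x τ = vSol I v₀ w₀ x t := by
  obtain ⟨ε, hε, hanti⟩ := h.exists_vSol_antitone_of_frozen hfr hl hm hlx hxm hx ht ht0
  obtain ⟨ε', hε', hanti'⟩ := h.flip.exists_vSol_antitone_of_frozen (p := -q) (q := -p) (r := r)
    (s := s) (x := -x) (t := t) (l := -m) (m := -l)
    (fun y hy τ hτ => by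
      rw [vSol_flip, wSol_flip,
        hfr (-y) ⟨hy.1, by linarith [hy.2.2], by linarith [hy.2.1]⟩ τ hτ])
    (by simpa [mem_sflip] using hm) (by simpa [mem_sflip] using hl) (neg_lt_neg hxm)
    (neg_lt_neg hlx) ⟨neg_lt_neg hx.2, neg_lt_neg hx.1⟩ ht ht0
  have hxI : x ∈ I ∩ Ioo p q := ⟨h.ordConnected.out hl hm ⟨hlx.le, hxm.le⟩, hx⟩
  have hs : t < min s (min (t + ε) (t + ε')) :=
    lt_min ht.2 (lt_min (by linarith) (by linarith))
  filter_upwards [Ico_mem_nhdsGE hs] with τ hτ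
  have hτs := hτ.2.trans_le (min_le_left _ _)
  have hτε := hτ.2.trans_le ((min_le_right _ _).trans (min_le_left _ _))
  have hτε' := hτ.2.trans_le ((min_le_right _ _).trans (min_le_right _ _))
  refine le_antisymm (hanti t τ (by linarith) hτ.1 hτε) ?_
  have := hanti' t τ (by linarith) hτ.1 hτε'
  simp only [vSol_flip, neg_neg, neg_le_neg_iff] at this
  rwa [← hfr x hxI t ht, ← hfr x hxI τ ⟨ht.1.trans_le hτ.1, hτs⟩] at this

lemma continuousOn_vSol_time {x a b : ℝ} (hx : x ∈ I) (ha : 0 ≤ a) :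
    ContinuousOn (fun τ => vSol I v₀ w₀ x τ) (Icc a b) :=
  h.continuousOn_vSol.comp (f := fun τ : ℝ => (x, τ)) (by fun_prop)
    fun _ hτ => ⟨hx, ha.trans hτ.1⟩

lemma vSol_eq_of_frozen_interior {p q r s x t t' l m : ℝ}
    (hfr : ∀ y ∈ I ∩ Ioo p q, ∀ τ ∈ Ioo r s, vSol I v₀ w₀ y τ = wSol I v₀ w₀ y τ)
    (hl : l ∈ I) (hm : m ∈ I) (hlx : l < x) (hxm : x < m) (hx : x ∈ Ioo p q) (ht : t ∈ Ioo r s)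
    (ht' : t' ∈ Ioo r s) (ht0 : 0 < t) (htt : t ≤ t') :
    vSol I v₀ w₀ x t' = vSol I v₀ w₀ x t :=
  eq_of_eventually_eq_right htt
    (h.continuousOn_vSol_time (h.ordConnected.out hl hm ⟨hlx.le, hxm.le⟩) ht0.le) fun _ hτ =>
      h.vSol_eventually_eq_of_frozen hfr hl hm hlx hxm hx ⟨ht.1.trans_le hτ.1, hτ.2.trans ht'.2⟩
        (ht0.trans_le hτ.1)

/-- Includes the right end of `I`, reached as a limit of interior points; the left end then follows
by reflection. -/
lemma vSol_eq_of_frozen_of_gt {p q r s x t t' l : ℝ}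
    (hfr : ∀ y ∈ I ∩ Ioo p q, ∀ τ ∈ Ioo r s, vSol I v₀ w₀ y τ = wSol I v₀ w₀ y τ)
    (hl : l ∈ I) (hlx : l < x) (hxI : x ∈ I) (hx : x ∈ Ioo p q) (ht : t ∈ Ioo r s)
    (ht' : t' ∈ Ioo r s) (ht0 : 0 < t) (htt : t ≤ t') :
    vSol I v₀ w₀ x t' = vSol I v₀ w₀ x t := by
  have hlp : max l p < x := max_lt hlx hx.1
  have hmem : ∀ᶠ y in 𝓝[<] x, y ∈ Ioo (max l p) x := Ioo_mem_nhdsLT hlp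
  have hT : ∀ τ, 0 ≤ τ →
      Tendsto (fun y => vSol I v₀ w₀ y τ) (𝓝[<] x) (𝓝 (vSol I v₀ w₀ x τ)) := by
    intro τ hτ
    refine (h.continuousOn_vSol (x, τ) ⟨hxI, hτ⟩).tendsto.comp (f := fun y : ℝ => (y, τ)) ?_
    refine tendsto_nhdsWithin_iff.2 ⟨?_, ?_⟩
    · exact ((continuous_id.prodMk continuous_const).tendsto x).mono_left nhdsWithin_le_nhds
    · filter_upwards [hmem] with y hy
      exact ⟨h.ordConnected.out hl hxI ⟨((le_max_left _ _).trans_lt hy.1).le, hy.2.le⟩, hτ⟩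
  refine tendsto_nhds_unique_of_eventuallyEq (hT t' (ht0.le.trans htt)) (hT t ht0.le) ?_
  filter_upwards [hmem] with y hy
  exact h.vSol_eq_of_frozen_interior hfr hl hxI ((le_max_left _ _).trans_lt hy.1) hy.2
    ⟨(le_max_right _ _).trans_lt hy.1, hy.2.trans hx.2⟩ ht ht' ht0 htt

/-- In a frozen region the right-moving field does not depend on time. -/
lemma vSol_eq_of_frozen {p q r s x t t' : ℝ}
    (hfr : ∀ y ∈ I ∩ Ioo p q, ∀ τ ∈ Ioo r s, vSol I v₀ w₀ y τ = wSol I v₀ w₀ y τ)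
    (hx : x ∈ I ∩ Ioo p q) (ht : t ∈ Ioo r s) (ht' : t' ∈ Ioo r s) (ht0 : 0 < t) (htt : t ≤ t') :
    vSol I v₀ w₀ x t' = vSol I v₀ w₀ x t := by
  by_cases hmin : ∀ y ∈ I, x ≤ y
  · obtain ⟨m, hm, hxm⟩ := h.not_max_of_min hmin
    have := h.flip.vSol_eq_of_frozen_of_gt (p := -q) (q := -p) (r := r) (s := s) (x := -x)
      (l := -m) (fun y hy τ hτ => by
        rw [vSol_flip, wSol_flip,
          hfr (-y) ⟨hy.1, by linarith [hy.2.2], by linarith [hy.2.1]⟩ τ hτ])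
      (by simpa [mem_sflip] using hm) (neg_lt_neg hxm) (by simpa [mem_sflip] using hx.1)
      ⟨neg_lt_neg hx.2.2, neg_lt_neg hx.2.1⟩ ht ht' ht0 htt
    rw [vSol_flip, vSol_flip, neg_neg, neg_inj] at this
    rwa [h.vSol_of_min hmin, h.vSol_of_min hmin]
  · push Not at hmin
    obtain ⟨l, hl, hlx⟩ := hmin
    exact h.vSol_eq_of_frozen_of_gt hfr hl hlx hx.1 hx.2 ht ht' ht0 htt

lemma exists_lt_gt_of_liquid {x t : ℝ} (hliq : wSol I v₀ w₀ x t < vSol I v₀ w₀ x t) :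
    (∃ l ∈ I, l < x) ∧ ∃ m ∈ I, x < m := by
  constructor
  · by_contra! hmin
    exact hliq.ne' (h.vSol_of_min hmin)
  · by_contra! hmax
    exact hliq.ne' (h.vSol_of_max hmax)

lemma vSol_eq_of_liquid {p q r s x t δ : ℝ}
    (hliq : ∀ y ∈ I ∩ Ioo p q, ∀ τ ∈ Ioo r s, 0 < τ ∧ wSol I v₀ w₀ y τ < vSol I v₀ w₀ y τ)
    (hx : x ∈ I ∩ Ioo p q) (ht : t ∈ Ioo r s) (hx' : x + δ ∈ I ∩ Ioo p q)
    (ht' : t + δ ∈ Ioo r s) : vSol I v₀ w₀ (x + δ) (t + δ) = vSol I v₀ w₀ x t := by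
  wlog hδ : 0 ≤ δ generalizing x t δ
  · have := this (x := x + δ) (t := t + δ) (δ := -δ) hx' ht' (by simpa using hx)
      (by simpa using ht) (by linarith)
    simpa using this.symm
  obtain ⟨l, hl, hlx⟩ := (h.exists_lt_gt_of_liquid (hliq x hx t ht).2).1
  obtain ⟨m, hm, hxm⟩ := (h.exists_lt_gt_of_liquid (hliq _ hx' _ ht').2).2
  refine h.vSol_add_of_liquid hl hm hlx hxm (hliq x hx t ht).1 hδ fun β hβ => ?_
  refine (hliq _ ⟨h.ordConnected.out hx.1 hx'.1 ⟨?_, ?_⟩, ?_, ?_⟩ _ ⟨?_, ?_⟩).2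
  all_goals linarith [hβ.1, hβ.2, hx.2.1, hx'.2.2, ht.1, ht'.2]

lemma solvesTransport {D : Set (ℝ × ℝ)} (hD : D ⊆ I ×ˢ Ioi 0) :
    SolvesTransport I (vSol I v₀ w₀) (wSol I v₀ w₀) D := by
  rintro p q r s F rfl hF
  have hpos : ∀ y ∈ I ∩ Ioo p q, ∀ τ ∈ Ioo r s, 0 < τ := fun y hy τ hτ =>
    (hD (hF (mk_mem_prod hy hτ))).2
  have hneg : ∀ y, y ∈ sflip I ∩ Ioo (-q) (-p) ↔ -y ∈ I ∩ Ioo p q := by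
    intro y
    simp only [mem_inter_iff, mem_sflip, mem_Ioo]
    constructor <;> rintro ⟨h1, h2, h3⟩ <;> exact ⟨h1, by linarith, by linarith⟩
  refine ⟨fun hliq => ⟨fun x t δ hx hx' => ?_, fun x t δ hx hx' => ?_⟩,
    fun hfr => ?_⟩
  · exact h.vSol_eq_of_liquid (fun y hy τ hτ => ⟨hpos y hy τ hτ, hliq y τ ⟨hy, hτ⟩⟩)
      hx.1 hx.2 hx'.1 hx'.2
  · have := h.flip.vSol_eq_of_liquid (p := -q) (q := -p) (r := r) (s := s) (x := -x) (t := t)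
      (δ := δ) (fun y hy τ hτ => by
        rw [hneg] at hy
        refine ⟨hpos _ hy τ hτ, ?_⟩
        rw [vSol_flip, wSol_flip]
        exact neg_lt_neg (hliq _ τ ⟨hy, hτ⟩)) ((hneg _).2 (by simpa using hx.1)) hx.2
      ((hneg _).2 (by simpa [sub_eq_add_neg, add_comm] using hx'.1)) hx'.2
    rw [vSol_flip, vSol_flip, neg_inj] at this
    simpa [sub_eq_add_neg, add_comm] using this
  · have hv : ∀ x t δ, (x, t) ∈ (I ∩ Ioo p q) ×ˢ Ioo r s →
        (x, t + δ) ∈ (I ∩ Ioo p q) ×ˢ Ioo r s →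
        vSol I v₀ w₀ x (t + δ) = vSol I v₀ w₀ x t := by
      intro x t δ hx hx'
      rcases le_total 0 δ with hδ | hδ
      · exact h.vSol_eq_of_frozen (fun y hy τ hτ => hfr y τ ⟨hy, hτ⟩) hx.1 hx.2 hx'.2
          (hpos x hx.1 t hx.2) (by linarith)
      · exact (h.vSol_eq_of_frozen (fun y hy τ hτ => hfr y τ ⟨hy, hτ⟩) hx.1 hx'.2 hx.2
          (hpos x hx.1 _ hx'.2) (by linarith)).symm
    refine ⟨hv, fun x t δ hx hx' => ?_⟩
    rw [← hfr _ _ hx, ← hfr _ _ hx', hv x t δ hx hx']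

/-! ### The thawing condition -/

/-- If every value of the right-moving field on `(x₁, x₂)` at time `s` exceeds all values of the
left-moving field to its right, then the right-moving field is transported through the triangle. -/
lemma vSol_eq_of_thawing {s x₁ x₂ x t : ℝ} (hs : 0 ≤ s) (hI : Ioo x₁ x₂ ⊆ I)
    (hbase : ∀ y z, x₁ < y → y < z → z < x₂ → wSol I v₀ w₀ z s < vSol I v₀ w₀ y s)
    (hz : (x, t) ∈ triangle s x₁ x₂) :
    vSol I v₀ w₀ x t = vSol I v₀ w₀ (x - (t - s)) s := by
  obtain ⟨hst, hx1, hx2⟩ : s ≤ t ∧ x₁ + (t - s) < x ∧ x < x₂ - (t - s) := hz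
  have hnear : ∀ z, x₁ < z → z < x₂ → ∃ l ∈ I, ∃ m ∈ I, l < z ∧ z < m := fun z h1 h2 =>
    ⟨(x₁ + z) / 2, hI ⟨by linarith, by linarith⟩, (z + x₂) / 2, hI ⟨by linarith, by linarith⟩,
      by linarith, by linarith⟩
  set x₀ := x - (t - s) with hx₀
  obtain ⟨-, -, m, hm, -, hxm⟩ := hnear x (by linarith) (by linarith)
  have hx₀I : x₀ ∈ I := hI ⟨by linarith, by linarith⟩
  have hxI : x ∈ I := hI ⟨by linarith, by linarith⟩
  have e1 : x = x₀ + (t - s) := by rw [hx₀]; ring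
  have hmono := h.vSol_mono (x := x₀) (t := s) (δ := t - s) hx₀I hm (by linarith) hs (by linarith)
  rw [← e1, add_sub_cancel] at hmono
  refine (hmono.antisymm ?_).symm
  by_contra! hlt
  obtain ⟨c, hc, hc'⟩ := exists_between hlt
  have hst' : 0 < t - s := by
    refine lt_of_le_of_ne (by linarith) fun heq => ?_
    have h1 : t = s := by linarith
    have h2 : x₀ = x := by rw [hx₀, h1]; ring
    rw [h1, h2] at hlt
    exact lt_irrefl _ hlt
  have hpath : Tendsto (fun η : ℝ => (x₀ + η, s + η)) (𝓝[>] 0) (𝓝[I ×ˢ Ici 0] (x₀, s)) := by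
    refine tendsto_nhdsWithin_iff.2 ⟨?_, ?_⟩
    · have : Continuous fun η : ℝ => (x₀ + η, s + η) := by fun_prop
      simpa using (this.tendsto 0).mono_left nhdsWithin_le_nhds
    · filter_upwards [Ioo_mem_nhdsGT hst'] with η hη
      exact ⟨h.ordConnected.out hx₀I hxI ⟨by linarith [hη.1], by linarith [hη.2]⟩,
        show (0 : ℝ) ≤ s + η by linarith [hη.1]⟩
  -- A short step of length `η` up the characteristic separates the two characteristic coordinates,
  -- which coincide when `s = 0`, and leaves `v` below `c`.
  have hev := ((h.continuousOn_vSol (x₀, s) ⟨hx₀I, hs⟩).tendsto.comp hpath).eventually_lt_const hc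
  obtain ⟨η, hη, hη'⟩ := (hev.and (Ioo_mem_nhdsGT hst')).exists
  obtain ⟨hη1, hη2⟩ : 0 < η ∧ η < t - s := hη'
  have hcη : vSol I v₀ w₀ (x₀ + η) (s + η) < c := hη
  have hcv1 : upper (extend I v₀) (extend I w₀) (x₀ - s) (x₀ + s + 2 * η) < c := by
    have : upperField I v₀ w₀ (x₀ + η) (s + η) < c := by
      rw [← h.coe_vSol (h.ordConnected.out hx₀I hxI ⟨by linarith, by linarith⟩) hm (by linarith)
        (by linarith)]
      exact_mod_cast hcη
    rw [upperField] at this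
    convert this using 2 <;> ring
  have hcv2 : c < upper (extend I v₀) (extend I w₀) (x₀ - s) (x + t) := by
    have : c < upperField I v₀ w₀ x t := by
      rw [← h.coe_vSol hxI hm hxm (by linarith)]
      exact_mod_cast hc'
    rw [upperField] at this
    convert this using 2
    rw [hx₀]; ring
  obtain ⟨y, hy, hya⟩ := exists_le_lower h.admissible (by linarith) (by linarith) hcv1 hcv2
  have hy1 := hy.1
  have hy2 := hy.2
  obtain ⟨l', hl', m', hm', hlz, hzm⟩ := hnear (y - s) (by linarith) (by linarith)
  -- The left-moving characteristic `x + t = y` meets the base at `y - s`, so the level `c` is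
  -- already attained there by `w`, to the right of `x₀`. This contradicts `hbase`.
  have hw : c ≤ wSol I v₀ w₀ (y - s) s := by
    refine h.le_wSol_of_eventually (σ := -1) hl' hm' hlz hzm hs ?_
    filter_upwards [Ioo_mem_nhdsGT hη1] with θ hθ
    refine ⟨by linarith [hθ.1], ?_⟩
    convert hya (y - 2 * s - 2 * θ) ⟨by linarith [hθ.2], by linarith [hθ.1]⟩ using 2 <;> ring
  linarith [hbase x₀ (y - s) (by linarith) (by linarith) (by linarith)]

end InitialData

section Triangle

variable {s x₁ x₂ x t : ℝ}

lemma mem_interior_triangle (hs : s < t) (h₁ : x₁ + (t - s) < x) (h₂ : x < x₂ - (t - s)) :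
    (x, t) ∈ interior (triangle s x₁ x₂) := by
  have hO : IsOpen {z : ℝ × ℝ | s < z.2 ∧ x₁ + (z.2 - s) < z.1 ∧ z.1 < x₂ - (z.2 - s)} :=
    (isOpen_lt continuous_const continuous_snd).inter
      ((isOpen_lt (by fun_prop) continuous_fst).inter (isOpen_lt continuous_fst (by fun_prop)))
  have hsub : {z : ℝ × ℝ | s < z.2 ∧ x₁ + (z.2 - s) < z.1 ∧ z.1 < x₂ - (z.2 - s)} ⊆
      triangle s x₁ x₂ := fun z hz => ⟨hz.1.le, hz.2⟩
  exact interior_maximal hsub hO ⟨hs, h₁, h₂⟩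

lemma triangle_flip : (x, t) ∈ triangle s x₁ x₂ ↔ (-x, t) ∈ triangle s (-x₂) (-x₁) := by
  simp only [triangle, mem_ofPred_eq]
  constructor <;> rintro ⟨h1, h2, h3⟩ <;> exact ⟨h1, by linarith, by linarith⟩

lemma exists_rectangle (hs : s < t) (h₁ : x₁ + (t - s) < x) (h₂ : x < x₂ - (t - s)) :
    ∃ ε > 0, Ioo (x - ε) (x + ε) ×ˢ Ioo (t - ε) (t + ε) ⊆ interior (triangle s x₁ x₂) := by
  obtain ⟨ε, hε, hball⟩ := Metric.isOpen_iff.1 isOpen_interior _ (mem_interior_triangle hs h₁ h₂)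
  refine ⟨ε, hε, ?_⟩
  rwa [← ball_prod_same, Real.ball_eq_Ioo, Real.ball_eq_Ioo] at hball

variable {v w : ℝ → ℝ → ℝ}
  (hI : Ioo x₁ x₂ ⊆ I) (hsol : SolvesTransport I v w (triangle s x₁ x₂))
  (hliq : ∀ x t, (x, t) ∈ interior (triangle s x₁ x₂) → w x t < v x t)
  (hz : (x, t) ∈ triangle s x₁ x₂)
include hI hsol hliq hz

/-- Going back in time, a small liquid rectangle surrounds each point of the characteristic above
the base, so `v` is locally constant along it. Continuity on the triangle reaches the base itself.
-/
lemma transport_right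
    (hv : ContinuousOn (fun z : ℝ × ℝ => v z.1 z.2) (triangle s x₁ x₂)) :
    v x t = v (x - (t - s)) s := by
  obtain ⟨hst, hx1, hx2⟩ : s ≤ t ∧ x₁ + (t - s) < x ∧ x < x₂ - (t - s) := hz
  have key := eq_of_eventually_eq_right (φ := fun β => v (x - β) (t - β)) (a := 0) (b := t - s)
    (by linarith) (hv.comp (f := fun β : ℝ => (x - β, t - β)) (by fun_prop) fun β hβ =>
      (show s ≤ t - β ∧ x₁ + (t - β - s) < x - β ∧ x - β < x₂ - (t - β - s) from
        ⟨by linarith [hβ.2], by linarith, by linarith [hβ.1]⟩)) fun β hβ => ?_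
  · simpa using key.symm
  obtain ⟨ε, hε, hrect⟩ := exists_rectangle (s := s) (t := t - β) (x₁ := x₁) (x₂ := x₂)
    (x := x - β) (by linarith [hβ.2]) (by linarith) (by linarith [hβ.1])
  have hF : (I ∩ Ioo (x - β - ε) (x - β + ε)) ×ˢ Ioo (t - β - ε) (t - β + ε) ⊆
      interior (triangle s x₁ x₂) := fun z hz => hrect ⟨hz.1.2, hz.2⟩
  have hcon := ((hsol _ _ _ _ _ rfl (hF.trans interior_subset)).1
    fun x t hxt => hliq x t (hF hxt)).1
  have hmin : β < min (β + ε) (t - s) := lt_min (by linarith) hβ.2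
  filter_upwards [Ico_mem_nhdsGE hmin] with γ hγ
  have h1 := hγ.2.trans_le (min_le_left _ _)
  have h2 := hγ.2.trans_le (min_le_right _ _)
  have h3 := hγ.1
  have h4 := hβ.1
  have := hcon (x - β) (t - β) (β - γ)
    ⟨⟨hI ⟨by linarith, by linarith⟩, by linarith, by linarith⟩, by linarith, by linarith⟩
    ⟨⟨hI ⟨by linarith, by linarith⟩, by linarith, by linarith⟩, by linarith, by linarith⟩
  simpa using this

lemma transport_left
    (hw : ContinuousOn (fun z : ℝ × ℝ => w z.1 z.2) (triangle s x₁ x₂)) :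
    w x t = w (x + (t - s)) s := by
  obtain ⟨hst, hx1, hx2⟩ : s ≤ t ∧ x₁ + (t - s) < x ∧ x < x₂ - (t - s) := hz
  have key := eq_of_eventually_eq_right (φ := fun β => w (x + β) (t - β)) (a := 0) (b := t - s)
    (by linarith) (hw.comp (f := fun β : ℝ => (x + β, t - β)) (by fun_prop) fun β hβ =>
      (show s ≤ t - β ∧ x₁ + (t - β - s) < x + β ∧ x + β < x₂ - (t - β - s) from
        ⟨by linarith [hβ.2], by linarith [hβ.1], by linarith⟩)) fun β hβ => ?_
  · simpa using key.symm
  obtain ⟨ε, hε, hrect⟩ := exists_rectangle (s := s) (t := t - β) (x₁ := x₁) (x₂ := x₂)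
    (x := x + β) (by linarith [hβ.2]) (by linarith [hβ.1]) (by linarith)
  have hF : (I ∩ Ioo (x + β - ε) (x + β + ε)) ×ˢ Ioo (t - β - ε) (t - β + ε) ⊆
      interior (triangle s x₁ x₂) := fun z hz => hrect ⟨hz.1.2, hz.2⟩
  have hcon := ((hsol _ _ _ _ _ rfl (hF.trans interior_subset)).1
    fun x t hxt => hliq x t (hF hxt)).2
  have hmin : β < min (β + ε) (t - s) := lt_min (by linarith) hβ.2
  filter_upwards [Ico_mem_nhdsGE hmin] with γ hγ
  have h1 := hγ.2.trans_le (min_le_left _ _)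
  have h2 := hγ.2.trans_le (min_le_right _ _)
  have h3 := hγ.1
  have h4 := hβ.1
  have := hcon (x + β) (t - β) (β - γ)
    ⟨⟨hI ⟨by linarith, by linarith⟩, by linarith, by linarith⟩, by linarith, by linarith⟩
    ⟨⟨hI ⟨by linarith, by linarith⟩, by linarith, by linarith⟩, by linarith, by linarith⟩
  convert this using 2 <;> ring

end Triangle

lemma InitialData.satisfiesThawing (h : InitialData I v₀ w₀) :
    SatisfiesThawing I (vSol I v₀ w₀) (wSol I v₀ w₀) := by
  intro s x₁ x₂ hs _ hI v w hv hw hsol _ _ hliq hbase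
  have hright := fun x t hz => transport_right (x := x) (t := t) hI hsol hliq hz hv
  have hleft := fun x t hz => transport_left (x := x) (t := t) hI hsol hliq hz hw
  have hcross : ∀ y z, x₁ < y → y < z → z < x₂ → wSol I v₀ w₀ z s < vSol I v₀ w₀ y s := by
    intro y z hy hyz hz
    -- The right-moving characteristic from `y` and the left-moving one from `z` meet here. The
    -- strict inequality at this liquid point is carried back to the base.
    have hint : ((y + z) / 2, s + (z - y) / 2) ∈ interior (triangle s x₁ x₂) :=
      mem_interior_triangle (by linarith) (by linarith) (by linarith)
    have h1 := hliq _ _ hint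
    rw [hright _ _ (interior_subset hint), hleft _ _ (interior_subset hint),
      show (y + z) / 2 - (s + (z - y) / 2 - s) = y by ring,
      show (y + z) / 2 + (s + (z - y) / 2 - s) = z by ring] at h1
    rwa [(hbase y ⟨hy, by linarith⟩).1, (hbase z ⟨by linarith, hz⟩).2] at h1
  intro x t hz
  replace hz := interior_subset hz
  have ⟨hst, hx1, hx2⟩ : s ≤ t ∧ x₁ + (t - s) < x ∧ x < x₂ - (t - s) := hz
  constructor
  · rw [hright x t hz, h.vSol_eq_of_thawing hs hI hcross hz]
    exact (hbase _ ⟨by linarith, by linarith⟩).1.symm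
  · have := h.flip.vSol_eq_of_thawing (x₁ := -x₂) (x₂ := -x₁) hs
      (fun y hy => hI ⟨by linarith [hy.2], by linarith [hy.1]⟩)
      (fun y z hy hyz hz => by
        rw [wSol_flip, vSol_flip]
        exact neg_lt_neg (hcross _ _ (by linarith) (by linarith) (by linarith)))
      (triangle_flip.1 hz)
    rw [vSol_flip, vSol_flip, neg_inj, neg_neg, show -(-x - (t - s)) = x + (t - s) by ring] at this
    rw [hleft x t hz, this]
    exact (hbase _ ⟨by linarith, by linarith⟩).2.symm

end Freezing

open Freezing in
theorem theorem2p3 (I : Set ℝ)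
    (hI : I = univ ∨ ∃ a₁ a₂ : ℝ, a₁ < a₂ ∧ I = Icc a₁ a₂)
    (v₀ w₀ : ℝ → ℝ) (hv₀ : ContinuousOn v₀ I) (hw₀ : ContinuousOn w₀ I)
    (hle : ∀ x ∈ I, w₀ x ≤ v₀ x)
    (hbd : ∀ x ∈ frontier I, v₀ x = w₀ x) :
    ∃ v w : ℝ → ℝ → ℝ,
      (∀ x ∈ I, v x 0 = v₀ x ∧ w x 0 = w₀ x) ∧
      ContinuousOn (fun z : ℝ × ℝ => v z.1 z.2) (I ×ˢ Ici 0) ∧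
      ContinuousOn (fun z : ℝ × ℝ => w z.1 z.2) (I ×ˢ Ici 0) ∧
      SatisfiesConstraint v w (I ×ˢ Ici 0) ∧
      SatisfiesBoundary I v w (I ×ˢ Ici 0) ∧
      SatisfiesThawing I v w ∧
      ∀ D : Set (ℝ × ℝ), (∃ O : Set (ℝ × ℝ), IsOpen O ∧ D = O ∩ (I ×ˢ Ioi 0)) →
        ((∀ x t, (x, t) ∈ D → w x t < v x t) ∨ (∀ x t, (x, t) ∈ D → v x t = w x t)) →
        SolvesTransport I v w D := by
  have h : InitialData I v₀ w₀ := ⟨hI, hv₀, hw₀, hle, hbd⟩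
  refine ⟨vSol I v₀ w₀, wSol I v₀ w₀, fun x hx => ⟨h.vSol_zero hx, h.wSol_zero hx⟩,
    h.continuousOn_vSol, h.continuousOn_wSol, fun x t hz => h.wSol_le_vSol hz.1 hz.2,
    fun x t hz hx => ?_, h.satisfiesThawing, ?_⟩
  · rcases (h.mem_frontier_iff hz.1).1 hx with hmax | hmin
    · exact h.vSol_of_max hmax
    · exact h.vSol_of_min hmin
  · rintro D ⟨O, -, rfl⟩ -
    exact h.solvesTransport inter_subset_right
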